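/- Setting. Let $G$ be an undirected weighted graph on the nodes $[n]=\{1,\dots,n\}$ without self-loops, with symmetric nonnegative weighted adjacency matrix $A$ ($i\sim j$ iff $A_{ij}\neq 0$), degrees $d_i=\sum_j A_{ij}>0$ and $D=\mathrm{diag}(d_1,\dots,d_n)$. For $S\subseteq[n]$ let $\mathrm{vol}(S)=\sum_{i\in S}d_i$, let $\widehat{\mathrm{vol}}(S)=\sum_{i\in S}|\{j: j\sim i\}|$ (the volume when weights are ignored), let $\Phi(S)=\sum_{i\in S,\,j\notin S}A_{ij}/\min(\mathrm{vol}(S),\mathrm{vol}([n]\setminus S))$, and for $S\ne\emptyset$ let $H(S)=\min_{\emptyset\neq T\subseteq S}\Phi(T)$. Let $\alpha,\epsilon\in(0,1)$, $\rho>0$, and let $s\ge 0$ satisfy $\sum_i s_i=1$ and $\|s\|_\infty\ge\rho$. Put $$Q=D^{-1/2}\Big\{D-\tfrac{1-\alpha}{2}(D+A)\Big\}D^{-1/2},\qquad f(q)=\tfrac12\langle q,Qq\rangle-\alpha\langle s,D^{-1/2}q\rangle,\qquad \psi(q)=\rho\alpha\|D^{1/2}q\|_1+f(q).$$ Let $q_*$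 be the minimizer of $\psi$ over $\mathbb R^n$ and let $S_*=\{i: q_*(i)\neq 0\}$. Assume $S_*\neq\emptyset$ and $\|s\|_1/\rho\le\mathrm{vol}([n])/2$, and let $\mu=\alpha+\frac{1-\alpha}{4}H(S_*)^2$. Algorithm. Start with $q_0=0$ and $\nabla f(q_0)=-\alpha D^{-1/2}s$. While $\|D^{-1/2}\nabla f(q_k)\|_\infty>(1+\epsilon)\rho\alpha$, let $S_k=\{i: q_k(i)-\nabla_i f(q_k)\ge\rho\alpha d_i^{1/2}\}$ and $\Delta_k(i)=-(\nabla_i f(q_k)+\rho\alpha d_i^{1/2})$ for $i\in S_k$, set $q_{k+1}(i)=q_k(i)+\Delta_k(i)$ for $i\in S_k$ and $q_{k+1}(i)=q_k(i)$ otherwise, and, with $c_k(i)=\frac{1-\alpha}{2d_i^{1/2}}\sum_{l\sim i,\,l\in S_k}A_{il}\Delta_k(l)/d_l^{1/2}$, set $\nabla_i f(q_{k+1})=-\rho\alpha d_i^{1/2}-\frac{1-\alpha}{2}\Delta_k(i)-c_k(i)$ for $i\in S_k$, $\nabla_i f(q_{k+1})=\nabla_i f(q_k)-c_k(i)$ for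 $i\notin S_k$ with a neighbour in $S_k$, and $\nabla_i f(q_{k+1})=\nabla_i f(q_k)$ for all other $i$. On exit return $D^{1/2}q_k$. Theorem. There is an absolute constant $C>0$ such that for all such data the following holds. (1) The algorithm stops after a finite number $T$ of iterations, at a point $q_T$ with $\|D^{-1/2}\nabla f(q_T)\|_\infty\le(1+\epsilon)\rho\alpha$, and $$T\le C\,\frac1\mu\log\Big(\frac{2}{\epsilon^2\rho^2\alpha^2\min_j d_j}\Big).$$ (2) Its running time $t$ satisfies $$t\le C\,\frac{|S_*|+\widehat{\mathrm{vol}}(S_*)}{\mu}\log\Big(\frac{2}{\epsilon^2\rho^2\alpha^2\min_j d_j}\Big).$$ Here $t$ is the number of unit-cost operations (real arithmetic, comparisons, memory accesses, loop turns), not counting the initialization, of the implementation on a real-number RAM with adjacency lists that keeps a list of the nodes $i$ with $q_k(i)-\nabla_i f(q_k)>\rho\alpha d_i^{1/2}$, tests the termination criterion and performs the updates by traversing this list and the adjacency lists of its members, and then appends the neighbours that have come to exceed their thresholds; this implementation returns exactly $D^{1/2}q_T$. (3) If moreover $|S_*|\le K\,\mathrm{vol}(S_*)$ and $\widehat{\mathrm{vol}}(S_*)\le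 K\,\mathrm{vol}(S_*)$ for some real $K$, then $$t\le C K\,\frac{2}{\rho\mu}\log\Big(\frac{2}{\epsilon^2\rho^2\alpha^2\min_j d_j}\Big).$$ -/

import Mathlib

open scoped Matrix

noncomputable section

namespace LocalPageRank

/-! ### Weighted graphs -/

/-- An undirected weighted graph on `n` nodes without self-loops, given by its weighted adjacency
matrix; `i` and `j` are neighbours iff `A i j ≠ 0`. Unweighted graphs have 0-1 entries. -/
structure WGraph (n : ℕ) where
  A : Matrix (Fin n) (Fin n) ℝ
  symm : ∀ i j, A i j = A j i
  nonneg : ∀ i j, 0 ≤ A i j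
  loopless : ∀ i, A i i = 0

namespace WGraph

variable {n : ℕ} (G : WGraph n)

/-- `i ∼ j`. -/
def Adj (i j : Fin n) : Prop := G.A i j ≠ 0

/-- The (weighted) degree `d_i`. -/
def deg (i : Fin n) : ℝ := ∑ j, G.A i j

/-- `vol(S)`, the sum of the degrees over `S`. -/
def vol (S : Finset (Fin n)) : ℝ := ∑ i ∈ S, G.deg i

open Classical in
/-- The adjacency list of a node. -/
def nbrs (i : Fin n) : List (Fin n) := (List.finRange n).filter (fun j => G.Adj i j)

/-- The volume of `S` when the weights are ignored: the sum over `S` of the numbers of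
neighbours. -/
def volHat (S : Finset (Fin n)) : ℕ := ∑ i ∈ S, (G.nbrs i).length

/-- The conductance of a set of nodes. -/
def conductance (S : Finset (Fin n)) : ℝ :=
  (∑ i ∈ S, ∑ j ∈ Sᶜ, G.A i j) / min (G.vol S) (G.vol Sᶜ)

/-- The local conductance constant `H(S)`: the least conductance of a nonempty subset of `S`
(a minimum over a finite set, which is nonempty when `S` is). -/
def localConductance (S : Finset (Fin n)) : ℝ :=
  sInf (G.conductance '' {T | T.Nonempty ∧ T ⊆ S})

/-- `D^{-1/2}`. -/
def invSqrtD : Matrix (Fin n) (Fin n) ℝ := Matrix.diagonal fun i => (Real.sqrt (G.deg i))⁻¹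

/-- `Q = D^{-1/2} {D - ((1-α)/2) (D + A)} D^{-1/2}`. -/
def Q (α : ℝ) : Matrix (Fin n) (Fin n) ℝ :=
  G.invSqrtD * (Matrix.diagonal G.deg - ((1 - α) / 2) • (Matrix.diagonal G.deg + G.A)) * G.invSqrtD

/-- `f(q) = ⟨q, Q q⟩ / 2 - α ⟨s, D^{-1/2} q⟩`. -/
def f (α : ℝ) (s q : Fin n → ℝ) : ℝ :=
  1 / 2 * (q ⬝ᵥ (G.Q α *ᵥ q)) - α * (s ⬝ᵥ (G.invSqrtD *ᵥ q))

/-- The objective `ψ(q) = ρ α ‖D^{1/2} q‖₁ + f(q)` of `ℓ₁`-regularized PageRank. -/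
def psi (α ρ : ℝ) (s q : Fin n → ℝ) : ℝ :=
  ρ * α * (∑ i, |Real.sqrt (G.deg i) * q i|) + G.f α s q

/-- The restricted strong convexity parameter `μ = α + ((1-α)/4) H(S)²`. -/
def mu (α : ℝ) (S : Finset (Fin n)) : ℝ := α + (1 - α) / 4 * (G.localConductance S) ^ 2

end WGraph

/-- The `i`-th partial derivative of `F` at `q`, that is `∇_i F(q)`. -/
def gradAt {n : ℕ} (F : (Fin n → ℝ) → ℝ) (q : Fin n → ℝ) (i : Fin n) : ℝ :=
  fderiv ℝ F q (Pi.single i 1)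

/-- The support of a vector. -/
def supp {n : ℕ} (q : Fin n → ℝ) : Finset (Fin n) := {i | q i ≠ 0}

/-! ### The ISTA-equivalent solver -/

/-- What the solver maintains: the iterate `q_k` and the vector `g = ∇f(q_k)`. -/
structure Iterate (n : ℕ) where
  q : Fin n → ℝ
  g : Fin n → ℝ

section Solver

variable {n : ℕ} (G : WGraph n) (α ρ : ℝ)

/-- The threshold `ρ α d_i^{1/2}`. -/
def thr (i : Fin n) : ℝ := ρ * α * Real.sqrt (G.deg i)

/-- `q_0 = 0`, `∇f(q_0) = - α D^{-1/2} s`. -/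
def initIterate (s : Fin n → ℝ) : Iterate n where
  q := 0
  g := fun i => -α * (s i / Real.sqrt (G.deg i))

/-- `S_k = {i | q_k(i) - ∇_i f(q_k) ≥ ρ α d_i^{1/2}}`. -/
def activeSet (x : Iterate n) : Finset (Fin n) := {i | x.q i - x.g i ≥ thr G α ρ i}

/-- `Δq_k`, extended by zero outside `S_k`. -/
def delta (x : Iterate n) (i : Fin n) : ℝ :=
  if i ∈ activeSet G α ρ x then -(x.g i + thr G α ρ i) else 0

open Classical in
/-- `((1-α) / (2 d_i^{1/2})) ∑_{l ∼ i, l ∈ S_k} A_{il} Δq_k(l) / d_l^{1/2}`. -/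
def inflow (x : Iterate n) (i : Fin n) : ℝ :=
  (1 - α) / (2 * Real.sqrt (G.deg i)) *
    ∑ l ∈ (activeSet G α ρ x).filter (fun l => G.Adj l i),
      G.A i l * delta G α ρ x l / Real.sqrt (G.deg l)

open Classical in
/-- One pass through the loop body of the solver. -/
def nextIterate (x : Iterate n) : Iterate n where
  q := fun i => if i ∈ activeSet G α ρ x then x.q i + delta G α ρ x i else x.q i
  g := fun i =>
    if i ∈ activeSet G α ρ x then
      -thr G α ρ i - (1 - α) / 2 * delta G α ρ x i - inflow G α ρ x i
    else if ∃ l ∈ activeSet G α ρ x, G.Adj l i then x.g i - inflow G α ρ x i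
    else x.g i

/-- The state of the solver after `k` passes. -/
def iterate (s : Fin n → ℝ) (k : ℕ) : Iterate n :=
  (nextIterate G α ρ)^[k] (initIterate G α s)

/-- The termination criterion `‖D^{-1/2} g‖_∞ ≤ (1+ε) ρ α` (the norm on `Fin n → ℝ` is the
sup norm). -/
def Terminates (ε : ℝ) (g : Fin n → ℝ) : Prop :=
  ‖(fun i => g i / Real.sqrt (G.deg i))‖ ≤ (1 + ε) * ρ * α

/-- The solver performs exactly `T` iterations: the criterion holds for the first time at `T`. -/
def StopsAfter (ε : ℝ) (s : Fin n → ℝ) (T : ℕ) : Prop :=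
  Terminates G α ρ ε (iterate G α ρ s T).g ∧
    ∀ k < T, ¬ Terminates G α ρ ε (iterate G α ρ s k).g

end Solver

/-! ### A real-number RAM with unit costs

The graph is read through its degrees, its weights and its adjacency lists. Every literal, memory
access, arithmetic operation, comparison, assignment and turn of a loop costs one step. -/

/-- The real arrays of the machine, indexed by the nodes. -/
inductive Arr where
  | q | g | d | out

/-- The memory, with a step counter. `mark` is the indicator array of the list `act`. -/
structure Mem (n : ℕ) where
  q : Fin n → ℝ
  g : Fin n → ℝ
  d : Fin n → ℝ
  out : Fin n → ℝ
  act : List (Fin n)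
  mark : Fin n → Bool
  flag : Bool
  steps : ℕ

namespace Mem

variable {n : ℕ}

def get (m : Mem n) : Arr → Fin n → ℝ
  | .q => m.q
  | .g => m.g
  | .d => m.d
  | .out => m.out

def set (m : Mem n) (a : Arr) (i : Fin n) (v : ℝ) : Mem n :=
  match a with
  | .q => { m with q := Function.update m.q i v }
  | .g => { m with g := Function.update m.g i v }
  | .d => { m with d := Function.update m.d i v }
  | .out => { m with out := Function.update m.out i v }

/-- Charge `c` steps. -/
def tick (m : Mem n) (c : ℕ) : Mem n := { m with steps := m.steps + c }

end Mem

/-- Arithmetic expressions; `deg` and `wt` read the graph. -/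
inductive Expr (n : ℕ) where
  | const (c : ℝ)
  | read (a : Arr) (i : Fin n)
  | deg (i : Fin n)
  | wt (i j : Fin n)
  | add (x y : Expr n)
  | sub (x y : Expr n)
  | mul (x y : Expr n)
  | div (x y : Expr n)
  | sqrt (x : Expr n)
  | abs (x : Expr n)

namespace Expr

variable {n : ℕ}

def eval (G : WGraph n) (m : Mem n) : Expr n → ℝ
  | const c => c
  | read a i => m.get a i
  | deg i => G.deg i
  | wt i j => G.A i j
  | add x y => x.eval G m + y.eval G m
  | sub x y => x.eval G m - y.eval G m
  | mul x y => x.eval G m * y.eval G m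
  | div x y => x.eval G m / y.eval G m
  | sqrt x => Real.sqrt (x.eval G m)
  | abs x => |x.eval G m|

/-- The number of steps of an evaluation. -/
def cost : Expr n → ℕ
  | const _ => 1
  | read _ _ => 1
  | deg _ => 1
  | wt _ _ => 1
  | add x y => x.cost + y.cost + 1
  | sub x y => x.cost + y.cost + 1
  | mul x y => x.cost + y.cost + 1
  | div x y => x.cost + y.cost + 1
  | sqrt x => x.cost + 1
  | abs x => x.cost + 1

end Expr

/-- Commands. -/
inductive Cmd (n : ℕ) where
  | write (a : Arr) (i : Fin n) (e : Expr n)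
  /-- set or clear the flag -/
  | putFlag (b : Bool)
  /-- put `i` in front of the list `act`, and mark it -/
  | activate (i : Fin n)
  | ifLt (x y : Expr n) (c : Cmd n)
  | ifUnmarked (i : Fin n) (c : Cmd n)
  | seq (c₁ c₂ : Cmd n)
  /-- for all `i` on the list `act` as it is when the loop starts -/
  | forActive (c : Fin n → Cmd n)
  /-- for all `j` on the adjacency list of `i` -/
  | forNbr (i : Fin n) (c : Fin n → Cmd n)

/-- Execution of a command. -/
def Cmd.run {n : ℕ} (G : WGraph n) : Cmd n → Mem n → Mem n
  | write a i e, m => (m.set a i (e.eval G m)).tick (e.cost + 1)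
  | putFlag b, m => { m with flag := b }.tick 1
  | activate i, m =>
      { m with act := i :: m.act, mark := Function.update m.mark i true }.tick 1
  | ifLt x y c, m =>
      let m' := m.tick (x.cost + y.cost + 1)
      if x.eval G m < y.eval G m then c.run G m' else m'
  | ifUnmarked i c, m => if m.mark i then m.tick 1 else c.run G (m.tick 1)
  | seq c₁ c₂, m => c₂.run G (c₁.run G m)
  | forActive c, m => m.act.foldl (fun m' i => (c i).run G (m'.tick 1)) (m.tick 1)
  | forNbr i c, m => (G.nbrs i).foldl (fun m' j => (c j).run G (m'.tick 1)) (m.tick 1)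

/-- `WhileFlag G test body m m'`: started in the memory `m`, the loop "run `test`; if it leaves the
flag set, run `body` and repeat, else leave the loop" ends, in the memory `m'`. -/
inductive WhileFlag {n : ℕ} (G : WGraph n) (test body : Cmd n) : Mem n → Mem n → Prop where
  | halt (m : Mem n) (h : (test.run G m).flag = false) :
      WhileFlag G test body m ((test.run G m).tick 1)
  | step (m m' : Mem n) (h : (test.run G m).flag = true)
      (h' : WhileFlag G test body (body.run G ((test.run G m).tick 1)) m') :
      WhileFlag G test body m m'

/-! ### The solver as a program

`act` lists the nodes of `S_k` with `q_k(i) - ∇_i f(q_k) > ρ α d_i^{1/2}`; on the other nodes of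
`S_k` the update is zero. -/

section Program

variable {n : ℕ} (G : WGraph n) (α ρ ε : ℝ)

/-- `ρ α d_i^{1/2}`. -/
def thrExpr (i : Fin n) : Expr n := .mul (.const (ρ * α)) (.sqrt (.deg i))

/-- Set the flag iff the termination criterion fails at a node of `act`. -/
def testCmd : Cmd n :=
  .seq (.putFlag false) <|
  .forActive fun i =>
    .ifLt (.const ((1 + ε) * ρ * α)) (.div (.abs (.read .g i)) (.sqrt (.deg i))) (.putFlag true)

/-- `Δq(i) := -(g(i) + ρ α d_i^{1/2})` and `q(i) := q(i) + Δq(i)` on `act`. -/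
def updateIterateCmd : Cmd n :=
  .forActive fun i =>
    .seq (.write .d i (.sub (.const 0) (.add (.read .g i) (thrExpr α ρ i))))
      (.write .q i (.add (.read .q i) (.read .d i)))

/-- The new gradient: `-ρ α d_i^{1/2} - ((1-α)/2) Δq(i)` on `act`, and then every `l` on `act` sends
its contribution to its neighbours. -/
def updateGradientCmd : Cmd n :=
  .seq
    (.forActive fun i =>
      .write .g i (.sub (.sub (.const 0) (thrExpr α ρ i))
        (.mul (.const ((1 - α) / 2)) (.read .d i))))
    (.forActive fun l => .forNbr l fun j =>
      .write .g j (.sub (.read .g j)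
        (.mul (.div (.const (1 - α)) (.mul (.const 2) (.sqrt (.deg j))))
          (.div (.mul (.wt j l) (.read .d l)) (.sqrt (.deg l))))))

/-- Put on `act` the neighbours of `act` that now exceed their thresholds. -/
def updateActiveCmd : Cmd n :=
  .forActive fun l => .forNbr l fun j =>
    .ifUnmarked j
      (.ifLt (thrExpr α ρ j) (.sub (.read .q j) (.read .g j)) (.activate j))

/-- One iteration. -/
def bodyCmd : Cmd n :=
  .seq (updateIterateCmd α ρ) (.seq (updateGradientCmd α ρ) (updateActiveCmd α ρ))

/-- `p := D^{1/2} q`. -/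
def returnCmd : Cmd n :=
  .forActive fun i => .write .out i (.mul (.sqrt (.deg i)) (.read .q i))

/-- The memory after initialization: `q = 0`, `g = -α D^{-1/2} s`, the list `act` of the nodes above
their thresholds, and the step counter at zero. -/
def initMem (s : Fin n → ℝ) : Mem n where
  q := (initIterate G α s).q
  g := (initIterate G α s).g
  d := 0
  out := 0
  act := (List.finRange n).filter
    (fun i => thr G α ρ i < (initIterate G α s).q i - (initIterate G α s).g i)
  mark := fun i => decide (thr G α ρ i < (initIterate G α s).q i - (initIterate G α s).g i)
  flag := false
  steps := 0

/-- The program, started after initialization, halts after exactly `t` steps and returns `p`. -/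
def HaltsWith (s p : Fin n → ℝ) (t : ℕ) : Prop :=
  ∃ m, WhileFlag G (testCmd α ρ ε) (bodyCmd α ρ) (initMem G α ρ s) m ∧
    ((returnCmd (n := n)).run G m).out = p ∧ ((returnCmd (n := n)).run G m).steps = t

end Program

end LocalPageRank

end

/-!
Write `M = I - Q = ((1 - α) / 2) (I + D^{-1/2} A D^{-1/2})`. This matrix has nonnegative entries and
is positive semidefinite, and one iteration is a proximal gradient step: the nodes `i` with
`(M q_k + α D^{-1/2} s)_i` at least the threshold receive the excess over it.

*Monotonicity.* Because `M` has nonnegative entries, the iterates increase and stay below the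
minimizer `q_*` (`IsLowerIterate.next`), which is itself nonnegative (`isOptimal_of_isMinOn`).
Hence all nodes that ever exceed their thresholds lie in `S_*`, a node that does so once does so
forever, and the optimality conditions, summed over `S_*`, give `vol(S_*) ≤ 1 / ρ`
(`IsOptimal.mul_vol_supp_le`).

*Convergence.* Since `S_*` has at most half of the volume, a Cheeger inequality with Dirichlet
boundary conditions (`WGraph.dirichlet_cheeger`) shows that `⟨x, Q x⟩ ≥ μ ‖x‖²` for `x` supported
in `S_*`. The errors `e_k = q_* - q_k ≥ 0` satisfy `e_{k+1} ≤ M e_k` on `S_*` and vanish elsewhere,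
so that `‖e_{k+1}‖² ≤ ⟨e_{k+1}, M e_k⟩ ≤ (⟨e_{k+1}, M e_{k+1}⟩ + ⟨e_k, M e_k⟩) / 2`, and therefore
`‖e_{k+1}‖² ≤ (1 - μ) ‖e_k‖²` (`IsLowerIterate.contraction`). With `‖e_0‖² ≤ 1 / min d` this makes
`‖e_k‖² ≤ ε² ρ² α² min d` after `O(μ⁻¹ log (2 / (ε² ρ² α² min d)))` iterations, and then the
termination criterion holds (`exists_stopsAfter`). The logarithm is at least `log 2`, as `ρ ≤ 1` and
`ρ min d ≤ ρ vol(S_*) ≤ 1`, so additive constants are absorbed.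

*Running time.* The program keeps on its list exactly the nodes that strictly exceed their
thresholds (`Represents.run_body`); a node on the boundary of `S_k` has update zero. One turn of the
loop costs a constant for each listed node and each entry of its adjacency list, hence
`O(|S_*| + volHat(S_*))` (`exists_haltsWith`).
-/

open scoped Matrix

namespace LocalPageRank

/-! ### The quadratic form of `Q` -/

namespace WGraph

variable {n : ℕ} (G : WGraph n)

lemma Q_apply (α : ℝ) (i j : Fin n) :
    G.Q α i j = (Real.sqrt (G.deg i))⁻¹ *
      (Matrix.diagonal G.deg - ((1 - α) / 2) • (Matrix.diagonal G.deg + G.A)) i j *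
        (Real.sqrt (G.deg j))⁻¹ := by
  rw [Q, invSqrtD, Matrix.mul_diagonal, Matrix.diagonal_mul]

lemma Q_mulVec_apply (hd : ∀ i, 0 < G.deg i) (α : ℝ) (x : Fin n → ℝ) (i : Fin n) :
    (G.Q α *ᵥ x) i = (1 + α) / 2 * x i -
      (1 - α) / 2 * ∑ j, G.A i j * x j / (Real.sqrt (G.deg i) * Real.sqrt (G.deg j)) := by
  have key : ∀ j, G.Q α i j * x j = (if i = j then (1 + α) / 2 * x i else 0) -
      (1 - α) / 2 * (G.A i j * x j / (Real.sqrt (G.deg i) * Real.sqrt (G.deg j))) := by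
    intro j
    have hj : 0 < Real.sqrt (G.deg j) := Real.sqrt_pos.2 (hd j)
    have hi : 0 < Real.sqrt (G.deg i) := Real.sqrt_pos.2 (hd i)
    rw [Q_apply]
    by_cases h : i = j
    · subst h
      have hs : Real.sqrt (G.deg i) * Real.sqrt (G.deg i) = G.deg i :=
        Real.mul_self_sqrt (hd i).le
      simp only [Matrix.sub_apply, Matrix.smul_apply, Matrix.add_apply, Matrix.diagonal_apply_eq,
        smul_eq_mul, if_true]
      rw [hs, G.loopless i]
      have : (Real.sqrt (G.deg i))⁻¹ * (Real.sqrt (G.deg i))⁻¹ = (G.deg i)⁻¹ := by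
        rw [← mul_inv, hs]
      have hne := (hd i).ne'
      calc _ = ((Real.sqrt (G.deg i))⁻¹ * (Real.sqrt (G.deg i))⁻¹) *
            (G.deg i - (1 - α) / 2 * (G.deg i + 0)) * x i := by ring
        _ = _ := by rw [this]; field_simp; ring
    · simp only [Matrix.sub_apply, Matrix.smul_apply, Matrix.add_apply,
        Matrix.diagonal_apply_ne _ h, smul_eq_mul, if_neg h]
      field_simp
      ring
  rw [Matrix.mulVec, dotProduct]
  simp only [key, Finset.sum_sub_distrib, Finset.sum_ite_eq, Finset.mem_univ, if_true,
    Finset.mul_sum]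

lemma Q_symm (α : ℝ) (i j : Fin n) : G.Q α i j = G.Q α j i := by
  rw [Q_apply, Q_apply]
  simp only [Matrix.sub_apply, Matrix.smul_apply, Matrix.add_apply, G.symm i j,
    Matrix.diagonal_apply, smul_eq_mul]
  by_cases h : i = j
  · subst h; ring
  · rw [if_neg h, if_neg (Ne.symm h)]; ring

lemma dotProduct_Q_mulVec_comm (α : ℝ) (x y : Fin n → ℝ) :
    x ⬝ᵥ (G.Q α *ᵥ y) = y ⬝ᵥ (G.Q α *ᵥ x) := by
  have h : (G.Q α)ᵀ = G.Q α := by ext i j; exact G.Q_symm α j i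
  rw [Matrix.dotProduct_mulVec, dotProduct_comm, ← Matrix.mulVec_transpose, h]

lemma Q_apply_self (hd : ∀ i, 0 < G.deg i) (α : ℝ) (i : Fin n) : G.Q α i i = (1 + α) / 2 := by
  have h := G.Q_mulVec_apply hd α (Pi.single i 1) i
  rw [Matrix.mulVec_single_one, Finset.sum_eq_zero] at h
  · simpa using h
  · intro j _
    by_cases hj : j = i
    · subst hj; simp [G.loopless]
    · simp [hj]

lemma sum_mul_deg_eq (z : Fin n → ℝ) : ∑ i, ∑ j, G.A i j * z i = ∑ i, G.deg i * z i := by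
  refine Finset.sum_congr rfl fun i _ => ?_
  rw [deg, Finset.sum_mul]

lemma sum_mul_deg_eq' (z : Fin n → ℝ) : ∑ i, ∑ j, G.A i j * z j = ∑ i, G.deg i * z i := by
  rw [Finset.sum_comm, ← sum_mul_deg_eq]
  exact Finset.sum_congr rfl fun i _ => Finset.sum_congr rfl fun j _ => by rw [G.symm]

lemma sum_sq_eq_sum_deg (hd : ∀ i, 0 < G.deg i) (x : Fin n → ℝ) :
    x ⬝ᵥ x = ∑ i, G.deg i * (x i / Real.sqrt (G.deg i)) ^ 2 := by
  refine Finset.sum_congr rfl fun i _ => ?_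
  rw [div_pow, Real.sq_sqrt (hd i).le]
  have := (hd i).ne'
  field_simp

/-- Both quadratic forms `⟨x, Q x⟩` and `⟨x, (I - Q) x⟩` come down to the cross term
`∑ A_{ij} y_i y_j` in the coordinates `y = D^{-1/2} x`. -/
lemma dotProduct_Q_mulVec_eq_cross (hd : ∀ i, 0 < G.deg i) (α : ℝ) (x : Fin n → ℝ) :
    x ⬝ᵥ (G.Q α *ᵥ x) = (1 + α) / 2 * (x ⬝ᵥ x) - (1 - α) / 2 * ∑ i, ∑ j, G.A i j *
      ((x i / Real.sqrt (G.deg i)) * (x j / Real.sqrt (G.deg j))) := by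
  simp only [dotProduct, G.Q_mulVec_apply hd, Finset.mul_sum, ← Finset.sum_sub_distrib]
  refine Finset.sum_congr rfl fun i _ => ?_
  rw [mul_sub, Finset.mul_sum]
  congr 1
  · ring
  · refine Finset.sum_congr rfl fun j _ => ?_
    have hj : 0 < Real.sqrt (G.deg j) := Real.sqrt_pos.2 (hd j)
    have hi : 0 < Real.sqrt (G.deg i) := Real.sqrt_pos.2 (hd i)
    field_simp

lemma sum_mul_add_sq (y : Fin n → ℝ) : ∑ i, ∑ j, G.A i j * (y i + y j) ^ 2 =
    2 * (∑ i, G.deg i * y i ^ 2) + 2 * ∑ i, ∑ j, G.A i j * (y i * y j) := by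
  have h1 := G.sum_mul_deg_eq fun i => y i ^ 2
  have h2 := G.sum_mul_deg_eq' fun i => y i ^ 2
  have : ∑ i, ∑ j, G.A i j * (y i + y j) ^ 2 = ∑ i, ∑ j, G.A i j * y i ^ 2 +
      ∑ i, ∑ j, G.A i j * y j ^ 2 + 2 * ∑ i, ∑ j, G.A i j * (y i * y j) := by
    simp only [Finset.mul_sum, ← Finset.sum_add_distrib]
    exact Finset.sum_congr rfl fun i _ => Finset.sum_congr rfl fun j _ => by ring
  rw [this, h1, h2]; ring

lemma sum_mul_sub_sq (y : Fin n → ℝ) : ∑ i, ∑ j, G.A i j * (y i - y j) ^ 2 =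
    2 * (∑ i, G.deg i * y i ^ 2) - 2 * ∑ i, ∑ j, G.A i j * (y i * y j) := by
  have h1 := G.sum_mul_deg_eq fun i => y i ^ 2
  have h2 := G.sum_mul_deg_eq' fun i => y i ^ 2
  have : ∑ i, ∑ j, G.A i j * (y i - y j) ^ 2 = ∑ i, ∑ j, G.A i j * y i ^ 2 +
      ∑ i, ∑ j, G.A i j * y j ^ 2 - 2 * ∑ i, ∑ j, G.A i j * (y i * y j) := by
    simp only [Finset.mul_sum, ← Finset.sum_add_distrib, ← Finset.sum_sub_distrib]
    exact Finset.sum_congr rfl fun i _ => Finset.sum_congr rfl fun j _ => by ring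
  rw [this, h1, h2]; ring

lemma dotProduct_Q_mulVec (hd : ∀ i, 0 < G.deg i) (α : ℝ) (x : Fin n → ℝ) :
    x ⬝ᵥ (G.Q α *ᵥ x) = α * (x ⬝ᵥ x) + (1 - α) / 4 * ∑ i, ∑ j, G.A i j *
      (x i / Real.sqrt (G.deg i) - x j / Real.sqrt (G.deg j)) ^ 2 := by
  rw [G.dotProduct_Q_mulVec_eq_cross hd,
    G.sum_mul_sub_sq fun i => x i / Real.sqrt (G.deg i), G.sum_sq_eq_sum_deg hd]
  ring

lemma alpha_mul_le_dotProduct_Q (hd : ∀ i, 0 < G.deg i) {α : ℝ} (hα : α ≤ 1) (x : Fin n → ℝ) :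
    α * (x ⬝ᵥ x) ≤ x ⬝ᵥ (G.Q α *ᵥ x) := by
  rw [G.dotProduct_Q_mulVec hd]
  have : 0 ≤ ∑ i, ∑ j, G.A i j *
      (x i / Real.sqrt (G.deg i) - x j / Real.sqrt (G.deg j)) ^ 2 :=
    Finset.sum_nonneg fun i _ => Finset.sum_nonneg fun j _ =>
      mul_nonneg (G.nonneg i j) (sq_nonneg _)
  nlinarith [mul_nonneg (sub_nonneg.2 hα) this]

/-- `I - Q` is positive semidefinite. -/
lemma dotProduct_Q_mulVec_le (hd : ∀ i, 0 < G.deg i) {α : ℝ} (hα : α ≤ 1) (x : Fin n → ℝ) :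
    x ⬝ᵥ (G.Q α *ᵥ x) ≤ x ⬝ᵥ x := by
  have h := G.sum_mul_add_sq fun i => x i / Real.sqrt (G.deg i)
  have : 0 ≤ ∑ i, ∑ j, G.A i j *
      (x i / Real.sqrt (G.deg i) + x j / Real.sqrt (G.deg j)) ^ 2 :=
    Finset.sum_nonneg fun i _ => Finset.sum_nonneg fun j _ =>
      mul_nonneg (G.nonneg i j) (sq_nonneg _)
  rw [G.dotProduct_Q_mulVec_eq_cross hd]
  rw [h, ← G.sum_sq_eq_sum_deg hd] at this
  nlinarith [mul_nonneg (sub_nonneg.2 hα) this]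

/-- The gradient step `x ↦ x - Q x` is monotone: the entries of `I - Q` are nonnegative. -/
lemma sub_Q_mulVec_mono (hd : ∀ i, 0 < G.deg i) {α : ℝ} (hα : α ≤ 1) {x y : Fin n → ℝ}
    (h : x ≤ y) (i : Fin n) : x i - (G.Q α *ᵥ x) i ≤ y i - (G.Q α *ᵥ y) i := by
  rw [G.Q_mulVec_apply hd, G.Q_mulVec_apply hd]
  have h1 : ∑ j, G.A i j * x j / (Real.sqrt (G.deg i) * Real.sqrt (G.deg j)) ≤
      ∑ j, G.A i j * y j / (Real.sqrt (G.deg i) * Real.sqrt (G.deg j)) := by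
    refine Finset.sum_le_sum fun j _ => ?_
    have := G.nonneg i j
    have := h j
    gcongr
  nlinarith [mul_nonneg (sub_nonneg.2 hα) (sub_nonneg.2 h1),
    mul_nonneg (sub_nonneg.2 hα) (sub_nonneg.2 (h i))]

/-- The off-diagonal entries of `Q` are nonpositive. -/
lemma Q_mulVec_nonpos_of_eq_zero (hd : ∀ i, 0 < G.deg i) {α : ℝ} (hα : α ≤ 1) {x : Fin n → ℝ}
    (h : 0 ≤ x) {i : Fin n} (hi : x i = 0) : (G.Q α *ᵥ x) i ≤ 0 := by
  have := G.sub_Q_mulVec_mono hd hα h i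
  simp only [Matrix.mulVec_zero, Pi.zero_apply, hi] at this
  linarith

lemma A_le_deg (i j : Fin n) : G.A i j ≤ G.deg j := by
  rw [G.symm i j]
  exact Finset.single_le_sum (f := fun k => G.A j k) (fun k _ => G.nonneg j k) (Finset.mem_univ i)

/-- Every row of `Q` has Euclidean norm at most one. -/
lemma sq_Q_mulVec_le (hd : ∀ i, 0 < G.deg i) {α : ℝ} (h0 : 0 ≤ α) (hα : α ≤ 1) (x : Fin n → ℝ)
    (i : Fin n) : (G.Q α *ᵥ x) i ^ 2 ≤ x ⬝ᵥ x := by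
  set u := ∑ j, G.A i j * x j / (Real.sqrt (G.deg i) * Real.sqrt (G.deg j)) with hu
  have hxi : x i ^ 2 ≤ x ⬝ᵥ x := by
    rw [sq]
    exact Finset.single_le_sum (f := fun k => x k * x k) (fun k _ => mul_self_nonneg _)
      (Finset.mem_univ i)
  have hu2 : u ^ 2 ≤ x ⬝ᵥ x := by
    have h1 : u ^ 2 ≤ (∑ j, G.A i j / G.deg i) * ∑ j, G.A i j / G.deg j * x j ^ 2 := by
      refine Finset.sum_sq_le_sum_mul_sum_of_sq_le_mul _ (fun j _ => ?_) (fun j _ => ?_)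
        fun j _ => ?_
      · exact div_nonneg (G.nonneg i j) (hd i).le
      · exact mul_nonneg (div_nonneg (G.nonneg i j) (hd j).le) (sq_nonneg _)
      · refine le_of_eq ?_
        rw [div_pow, mul_pow, mul_pow, Real.sq_sqrt (hd i).le, Real.sq_sqrt (hd j).le]
        have := (hd i).ne'
        have := (hd j).ne'
        field_simp
    have h2 : ∑ j, G.A i j / G.deg i = 1 := by
      rw [← Finset.sum_div]; exact div_self (hd i).ne'
    rw [h2, one_mul] at h1
    refine h1.trans (Finset.sum_le_sum fun j _ => ?_)
    rw [← sq]
    exact mul_le_of_le_one_left (sq_nonneg _) ((div_le_one (hd j)).2 (G.A_le_deg i j))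
  rw [G.Q_mulVec_apply hd, ← hu]
  -- convexity of the square, with weights `(1 + α) / 2` and `(1 - α) / 2`
  have : ((1 + α) / 2 * x i - (1 - α) / 2 * u) ^ 2 ≤
      (1 + α) / 2 * x i ^ 2 + (1 - α) / 2 * u ^ 2 := by
    nlinarith [mul_nonneg (mul_nonneg (by linarith : (0 : ℝ) ≤ 1 + α) (sub_nonneg.2 hα))
      (sq_nonneg (x i + u))]
  nlinarith

/-! ### The Dirichlet form of Cheeger's inequality -/

lemma sum_indicator_abs_sub (T : Finset (Fin n)) :
    ∑ i, ∑ j, G.A i j * |(if i ∈ T then (1 : ℝ) else 0) - (if j ∈ T then 1 else 0)| =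
      2 * ∑ i ∈ T, ∑ j ∈ Tᶜ, G.A i j := by
  have h : ∀ i j, G.A i j * |(if i ∈ T then (1 : ℝ) else 0) - (if j ∈ T then 1 else 0)| =
      (if i ∈ T then if j ∈ Tᶜ then G.A i j else 0 else 0) +
      (if j ∈ T then if i ∈ Tᶜ then G.A j i else 0 else 0) := by
    intro i j
    by_cases hi : i ∈ T <;> by_cases hj : j ∈ T <;> simp [hi, hj, G.symm i j]
  have e : ∑ i, ∑ j, (if i ∈ T then if j ∈ Tᶜ then G.A i j else 0 else 0) =
      ∑ i ∈ T, ∑ j ∈ Tᶜ, G.A i j := by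
    rw [← Finset.sum_filter_add_sum_filter_not Finset.univ (· ∈ T)]
    rw [Finset.sum_eq_zero (s := Finset.univ.filter (· ∉ T))]
    · rw [add_zero, Finset.filter_univ_mem]
      refine Finset.sum_congr rfl fun i hi => ?_
      simp only [hi, if_true]
      rw [← Finset.sum_filter, Finset.filter_univ_mem]
    · intro i hi
      simp [(Finset.mem_filter.1 hi).2]
  simp only [h, Finset.sum_add_distrib]
  rw [e, Finset.sum_comm (f := fun i j => if j ∈ T then if i ∈ Tᶜ then G.A j i else 0 else 0), e]
  ring

/-- A discrete co-area inequality: if every nonempty `T ⊆ S` has a boundary of weight at least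
`h vol(T)`, then the total variation of a nonnegative function supported in `S` is at least `h`
times its weighted mass. The function is peeled layer by layer: the least positive value times the
indicator of the support is subtracted, which shrinks the support. -/
lemma coarea {S : Finset (Fin n)} {h : ℝ}
    (hS : ∀ T ⊆ S, T.Nonempty → h * G.vol T ≤ ∑ i ∈ T, ∑ j ∈ Tᶜ, G.A i j)
    (z : Fin n → ℝ) (hz : ∀ i, 0 ≤ z i) (hzS : supp z ⊆ S) :
    h * ∑ i, G.deg i * z i ≤ 1 / 2 * ∑ i, ∑ j, G.A i j * |z i - z j| := by
  induction hc : (supp z).card using Nat.strong_induction_on generalizing z with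
  | _ c ih =>
  rcases (supp z).eq_empty_or_nonempty with h0 | hne
  · have : ∀ i, z i = 0 := fun i => by
      by_contra hi
      have : i ∈ supp z := by simpa [supp] using hi
      simp [h0] at this
    simp [this]
  · obtain ⟨k, hk, hmin⟩ := (supp z).exists_min_image z hne
    set T := supp z with hT
    have memT : ∀ i, i ∈ T ↔ z i ≠ 0 := fun i => by simp [hT, supp]
    let χ : Fin n → ℝ := fun i => if i ∈ T then 1 else 0
    let w : Fin n → ℝ := fun i => z i - z k * χ i
    have hzw : ∀ i, z i = w i + z k * χ i := fun i => by simp [w]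
    have w_in : ∀ i ∈ T, w i = z i - z k := fun i hi => by simp [w, χ, hi]
    have w_out : ∀ i ∉ T, w i = 0 := fun i hi => by
      simp [w, χ, hi, not_not.1 (mt (memT i).2 hi)]
    have hw0 : ∀ i, 0 ≤ w i := fun i => by
      by_cases hi : i ∈ T
      · rw [w_in i hi]; linarith [hmin i hi]
      · rw [w_out i hi]
    have hsub : supp w ⊂ T := by
      refine Finset.ssubset_iff_of_subset (fun i hi => ?_) |>.2 ⟨k, hk, ?_⟩
      · by_contra hiT
        simp [supp, w_out i hiT] at hi
      · simp [supp, w_in k hk]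
    have hw := ih _ (hc ▸ Finset.card_lt_card hsub) w hw0 (hsub.subset.trans hzS) rfl
    have habs : ∀ i j, |z i - z j| = |w i - w j| + z k * |χ i - χ j| := by
      intro i j
      by_cases hi : i ∈ T <;> by_cases hj : j ∈ T
      · rw [w_in i hi, w_in j hj]; simp [χ, hi, hj]
      · have h1 := hw0 i
        rw [w_out j hj, hzw i, hzw j, w_out j hj]
        simp [χ, hi, hj, abs_of_nonneg h1, abs_of_nonneg (add_nonneg h1 (hz k))]
      · have h1 := hw0 j
        rw [w_out i hi, hzw i, hzw j, w_out i hi, abs_sub_comm]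
        simp [χ, hi, hj, abs_of_nonneg h1, abs_of_nonneg (add_nonneg h1 (hz k))]
      · rw [w_out i hi, w_out j hj, hzw i, hzw j, w_out i hi, w_out j hj]; simp [χ, hi, hj]
    have e1 : ∑ i, ∑ j, G.A i j * |z i - z j| = ∑ i, ∑ j, G.A i j * |w i - w j| +
        z k * ∑ i, ∑ j, G.A i j * |χ i - χ j| := by
      simp only [habs, Finset.mul_sum, ← Finset.sum_add_distrib]
      exact Finset.sum_congr rfl fun i _ => Finset.sum_congr rfl fun j _ => by ring
    have e2 : ∑ i, G.deg i * z i = ∑ i, G.deg i * w i + z k * G.vol T := by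
      have : G.vol T = ∑ i, G.deg i * χ i := by simp [vol, χ]
      rw [this, Finset.mul_sum, ← Finset.sum_add_distrib]
      exact Finset.sum_congr rfl fun i _ => by rw [hzw i]; ring
    rw [e1, e2, G.sum_indicator_abs_sub T]
    nlinarith [mul_le_mul_of_nonneg_left (hS T hzS hne) (hz k)]

/-- Cheeger's inequality with Dirichlet boundary conditions: functions supported in `S` have
Rayleigh quotient at least `h² / 2`, if every nonempty `T ⊆ S` has a boundary of weight at least
`h vol(T)`. The right-hand side counts every edge twice. -/
lemma dirichlet_cheeger {S : Finset (Fin n)} {h : ℝ} (h0 : 0 ≤ h)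
    (hS : ∀ T ⊆ S, T.Nonempty → h * G.vol T ≤ ∑ i ∈ T, ∑ j ∈ Tᶜ, G.A i j)
    (y : Fin n → ℝ) (hy : supp y ⊆ S) :
    h ^ 2 * ∑ i, G.deg i * y i ^ 2 ≤ ∑ i, ∑ j, G.A i j * (y i - y j) ^ 2 := by
  have hc := G.coarea hS (fun i => y i ^ 2) (fun i => sq_nonneg _)
    (fun i hi => hy (by simpa [supp] using hi))
  -- the weighted arithmetic-geometric mean inequality on each edge
  have hedge : ∀ i j, h * (G.A i j * |y i ^ 2 - y j ^ 2|) ≤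
      G.A i j * (y i - y j) ^ 2 + h ^ 2 / 4 * (G.A i j * (y i + y j) ^ 2) := by
    intro i j
    have : h * |y i ^ 2 - y j ^ 2| ≤ (y i - y j) ^ 2 + h ^ 2 / 4 * (y i + y j) ^ 2 := by
      have e : |y i ^ 2 - y j ^ 2| = |y i - y j| * |y i + y j| := by rw [← abs_mul]; ring_nf
      rw [e, ← sq_abs (y i - y j), ← sq_abs (y i + y j)]
      nlinarith [sq_nonneg (|y i - y j| - h / 2 * |y i + y j|)]
    nlinarith [mul_le_mul_of_nonneg_left this (G.nonneg i j)]
  have hsum : h * ∑ i, ∑ j, G.A i j * |y i ^ 2 - y j ^ 2| ≤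
      ∑ i, ∑ j, G.A i j * (y i - y j) ^ 2 +
        h ^ 2 / 4 * ∑ i, ∑ j, G.A i j * (y i + y j) ^ 2 := by
    simp only [Finset.mul_sum, ← Finset.sum_add_distrib]
    exact Finset.sum_le_sum fun i _ => Finset.sum_le_sum fun j _ => hedge i j
  have hE := G.sum_mul_sub_sq y
  have hF := G.sum_mul_add_sq y
  have hE0 : 0 ≤ ∑ i, ∑ j, G.A i j * (y i - y j) ^ 2 :=
    Finset.sum_nonneg fun i _ => Finset.sum_nonneg fun j _ =>
      mul_nonneg (G.nonneg i j) (sq_nonneg _)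
  set E := ∑ i, ∑ j, G.A i j * (y i - y j) ^ 2
  set F := ∑ i, ∑ j, G.A i j * (y i + y j) ^ 2
  set V := ∑ i, G.deg i * y i ^ 2
  have hFV : F ≤ 4 * V := by linarith
  nlinarith [mul_le_mul_of_nonneg_left hc h0, mul_le_mul_of_nonneg_left hFV (sq_nonneg h)]

/-! ### Restricted strong convexity -/

lemma localConductance_nonneg (hd : ∀ i, 0 < G.deg i) (S : Finset (Fin n)) :
    0 ≤ G.localConductance S := by
  refine Real.sInf_nonneg ?_
  rintro _ ⟨T, -, rfl⟩
  exact div_nonneg (Finset.sum_nonneg fun i _ => Finset.sum_nonneg fun j _ => G.nonneg i j)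
    (le_min (Finset.sum_nonneg fun i _ => (hd i).le) (Finset.sum_nonneg fun i _ => (hd i).le))

/-- On subsets of a set with at most half of the volume, the minimum in the definition of the
conductance is the volume of the subset itself. -/
lemma localConductance_mul_vol_le (hd : ∀ i, 0 < G.deg i) {S : Finset (Fin n)}
    (hS : G.vol S ≤ G.vol Finset.univ / 2) {T : Finset (Fin n)} (hT : T ⊆ S) (hne : T.Nonempty) :
    G.localConductance S * G.vol T ≤ ∑ i ∈ T, ∑ j ∈ Tᶜ, G.A i j := by
  have hTS : G.vol T ≤ G.vol S :=
    Finset.sum_le_sum_of_subset_of_nonneg hT fun i _ _ => (hd i).le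
  have hsum : G.vol T + G.vol Tᶜ = G.vol Finset.univ := Finset.sum_add_sum_compl T _
  have hpos : 0 < G.vol T := Finset.sum_pos (fun i _ => hd i) hne
  have hle : G.localConductance S ≤ G.conductance T :=
    csInf_le (Set.Finite.bddBelow (Set.toFinite _)) ⟨T, ⟨hne, hT⟩, rfl⟩
  rwa [conductance, min_eq_left (by linarith), le_div_iff₀ hpos] at hle

lemma le_mu {α : ℝ} (hα : α ≤ 1) (S : Finset (Fin n)) :
    α ≤ G.mu α S := by
  rw [mu]
  nlinarith [mul_nonneg (sub_nonneg.2 hα) (sq_nonneg (G.localConductance S))]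

/-- Restricted strong convexity: on vectors supported in `S` the form of `Q` is at least
`μ ‖x‖²`. -/
lemma mu_mul_le_dotProduct_Q (hd : ∀ i, 0 < G.deg i) {α : ℝ} (hα : α ≤ 1) {S : Finset (Fin n)}
    (hS : G.vol S ≤ G.vol Finset.univ / 2) {x : Fin n → ℝ} (hx : supp x ⊆ S) :
    G.mu α S * (x ⬝ᵥ x) ≤ x ⬝ᵥ (G.Q α *ᵥ x) := by
  have hy : supp (fun i => x i / Real.sqrt (G.deg i)) ⊆ S := fun i hi => hx <| by
    simp only [supp, Finset.mem_filter, Finset.mem_univ, true_and] at hi ⊢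
    exact fun h => hi (by rw [h, zero_div])
  have := G.dirichlet_cheeger (G.localConductance_nonneg hd S)
    (fun T hT hne => G.localConductance_mul_vol_le hd hS hT hne) _ hy
  rw [← G.sum_sq_eq_sum_deg hd] at this
  rw [G.dotProduct_Q_mulVec hd, mu]
  nlinarith [mul_le_mul_of_nonneg_left this (sub_nonneg.2 hα)]

/-! ### Optimality conditions for the regularized objective -/

/-- The gradient `Q q - α D^{-1/2} s` of `f`. -/
noncomputable def grad (α : ℝ) (s q : Fin n → ℝ) (i : Fin n) : ℝ :=
  (G.Q α *ᵥ q) i - α * (s i / Real.sqrt (G.deg i))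

lemma f_eq (α : ℝ) (s q : Fin n → ℝ) : G.f α s q =
    1 / 2 * (q ⬝ᵥ (G.Q α *ᵥ q)) - (fun i => α * (s i / Real.sqrt (G.deg i))) ⬝ᵥ q := by
  rw [f, invSqrtD]
  congr 1
  simp only [dotProduct, Matrix.mulVec_diagonal, Finset.mul_sum]
  exact Finset.sum_congr rfl fun i _ => by ring

/-- The second-order Taylor expansion of `f`, which is exact. -/
lemma f_add (α : ℝ) (s q h : Fin n → ℝ) :
    G.f α s (q + h) = G.f α s q + G.grad α s q ⬝ᵥ h + 1 / 2 * (h ⬝ᵥ (G.Q α *ᵥ h)) := by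
  have hg : G.grad α s q = G.Q α *ᵥ q - fun i => α * (s i / Real.sqrt (G.deg i)) := rfl
  rw [f_eq, f_eq, hg, Matrix.mulVec_add, add_dotProduct, dotProduct_add, dotProduct_add,
    dotProduct_add, sub_dotProduct, dotProduct_comm (G.Q α *ᵥ q) h,
    G.dotProduct_Q_mulVec_comm α q h]
  ring

lemma f_add_single (hd : ∀ i, 0 < G.deg i) (α : ℝ) (s q : Fin n → ℝ) (i : Fin n) (t : ℝ) :
    G.f α s (q + t • Pi.single i 1) =
      G.f α s q + t * G.grad α s q i + (1 + α) / 4 * t ^ 2 := by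
  rw [f_add, Matrix.mulVec_smul, smul_dotProduct, dotProduct_smul, dotProduct_smul,
    dotProduct_single_one, single_one_dotProduct, Matrix.mulVec_single_one, Matrix.col_apply,
    G.Q_apply_self hd]
  simp only [smul_eq_mul]
  ring

lemma gradAt_f (hd : ∀ i, 0 < G.deg i) (α : ℝ) (s q : Fin n → ℝ) :
    gradAt (G.f α s) q = G.grad α s q := by
  funext i
  have hdiff : DifferentiableAt ℝ (G.f α s) q := by
    unfold f dotProduct Matrix.mulVec dotProduct
    fun_prop
  have hline : HasLineDerivAt ℝ (G.f α s) (G.grad α s q i) q (Pi.single i 1) := by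
    rw [HasLineDerivAt]
    simp only [G.f_add_single hd]
    have h1 := ((hasDerivAt_id (0 : ℝ)).mul_const (G.grad α s q i)).const_add (G.f α s q)
    have h2 := ((hasDerivAt_id (0 : ℝ)).pow 2).const_mul ((1 + α) / 4)
    exact (h1.add h2).congr_deriv (by simp)
  rw [gradAt, ← hdiff.lineDeriv_eq_fderiv, hline.lineDeriv]

lemma psi_add_single (hd : ∀ i, 0 < G.deg i) (α ρ : ℝ) (s q : Fin n → ℝ) (i : Fin n) (t : ℝ) :
    G.psi α ρ s (q + t • Pi.single i 1) = G.psi α ρ s q +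
      (thr G α ρ i * (|q i + t| - |q i|) + t * G.grad α s q i + (1 + α) / 4 * t ^ 2) := by
  have h : ∑ j, |Real.sqrt (G.deg j) * (q + t • Pi.single i (1 : ℝ) : Fin n → ℝ) j| =
      ∑ j, |Real.sqrt (G.deg j) * q j| + Real.sqrt (G.deg i) * (|q i + t| - |q i|) := by
    rw [← sub_eq_iff_eq_add', ← Finset.sum_sub_distrib, Finset.sum_eq_single i]
    · simp [abs_mul, abs_of_nonneg (Real.sqrt_nonneg (G.deg i)), mul_sub]
    · intro j _ hj; simp [hj]
    · simp
  rw [psi, psi, h, G.f_add_single hd, thr]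
  ring

end WGraph

/-- A function `τ ↦ τ x + c τ²` that is nonnegative for small `τ > 0` has slope `x ≥ 0` at zero. -/
lemma nonneg_of_forall_small {x c a : ℝ} (ha : 0 < a)
    (h : ∀ τ, 0 < τ → τ ≤ a → 0 ≤ τ * x + c * τ ^ 2) : 0 ≤ x := by
  by_contra hx
  push Not at hx
  have hc : 0 < |c| + 1 := by positivity
  set τ := min a (-x / (2 * (|c| + 1))) with hτ
  have hpos : 0 < τ := lt_min ha (div_pos (by linarith) (by linarith))
  have h1 := h τ hpos (min_le_left _ _)
  have h2 : τ * (2 * (|c| + 1)) ≤ -x := (le_div_iff₀ (by linarith)).1 (min_le_right _ _)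
  have h3 : c ≤ |c| := le_abs_self c
  have h4 : 0 ≤ x + c * τ := by
    by_contra hcon
    push Not at hcon
    nlinarith [mul_neg_of_pos_of_neg hpos hcon]
  nlinarith [abs_nonneg c]

/-- The subdifferential of `lam * |·|` at `a`, where `-g` must lie. -/
lemma abs_optimality {lam a g c : ℝ} (hl : 0 ≤ lam)
    (h : ∀ t, 0 ≤ lam * (|a + t| - |a|) + t * g + c * t ^ 2) :
    -lam ≤ g ∧ (0 < a → g = -lam) ∧ (a < 0 → g = lam) := by
  have h1 : -lam ≤ g := by
    have := nonneg_of_forall_small (x := lam + g) (c := c) one_pos fun τ hτ _ => by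
      have h2 := abs_add_le a τ
      rw [abs_of_pos hτ] at h2
      nlinarith [h τ, mul_le_mul_of_nonneg_left h2 hl]
    linarith
  have h2 : g ≤ lam := by
    have := nonneg_of_forall_small (x := lam - g) (c := c) one_pos fun τ hτ _ => by
      have h2 := abs_add_le a (-τ)
      rw [abs_neg, abs_of_pos hτ] at h2
      nlinarith [h (-τ), mul_le_mul_of_nonneg_left h2 hl]
    linarith
  refine ⟨h1, fun ha => ?_, fun ha => ?_⟩
  · have := nonneg_of_forall_small (x := -lam - g) (c := c) ha fun τ hτ hτa => by
      have h3 := h (-τ)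
      rw [abs_of_pos ha, abs_of_nonneg (by linarith : 0 ≤ a + -τ)] at h3
      nlinarith
    linarith
  · have := nonneg_of_forall_small (x := g - lam) (c := c) (neg_pos.2 ha) fun τ hτ hτa => by
      have h3 := h τ
      rw [abs_of_neg ha, abs_of_nonpos (by linarith : a + τ ≤ 0)] at h3
      nlinarith
    linarith

/-- The first-order optimality conditions of `ψ`, for a nonnegative point. -/
structure IsOptimal {n : ℕ} (G : WGraph n) (α ρ : ℝ) (s q : Fin n → ℝ) : Prop where
  nonneg : 0 ≤ q
  neg_thr_le : ∀ i, -thr G α ρ i ≤ G.grad α s q i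
  grad_eq : ∀ i, q i ≠ 0 → G.grad α s q i = -thr G α ρ i

section Optimal

variable {n : ℕ} {G : WGraph n} {α ρ : ℝ} {s q : Fin n → ℝ}

lemma thr_nonneg (hα : 0 < α) (hρ : 0 < ρ) (i : Fin n) : 0 ≤ thr G α ρ i := by
  unfold thr; positivity

/-- A minimizer is nonnegative because `Q` has nonpositive off-diagonal entries and is positive
definite: both facts together force the negative part to vanish. -/
lemma isOptimal_of_isMinOn (hd : ∀ i, 0 < G.deg i) (hα : 0 < α) (hα1 : α < 1) (hρ : 0 < ρ)
    (hs : ∀ i, 0 ≤ s i) (hq : IsMinOn (G.psi α ρ s) Set.univ q) : IsOptimal G α ρ s q := by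
  have hopt : ∀ i, -thr G α ρ i ≤ G.grad α s q i ∧ (0 < q i → G.grad α s q i = -thr G α ρ i) ∧
      (q i < 0 → G.grad α s q i = thr G α ρ i) := fun i => by
    refine abs_optimality (c := (1 + α) / 4) (thr_nonneg hα hρ i) fun t => ?_
    have := isMinOn_univ_iff.1 hq (q + t • Pi.single i (1 : ℝ))
    rw [G.psi_add_single hd] at this
    linarith
  have h0 : 0 ≤ q := by
    let x : Fin n → ℝ := fun i => max (-q i) 0
    have hx0 : 0 ≤ x := fun i => le_max_right _ _
    have hadd : 0 ≤ q + x := fun i => by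
      have : -q i ≤ x i := le_max_left _ _
      simp only [Pi.zero_apply, Pi.add_apply]; linarith
    -- where `q` is negative, `Q q` is nonnegative and `Q (q + x)` is nonpositive
    have hterm : ∀ i, x i * (G.Q α *ᵥ x) i ≤ 0 := fun i => by
      rcases le_or_gt 0 (q i) with hi | hi
      · simp [x, hi]
      · have hxi : x i = -q i := max_eq_left (by linarith)
        have h1 : (G.Q α *ᵥ (q + x)) i ≤ 0 :=
          G.Q_mulVec_nonpos_of_eq_zero hd hα1.le hadd (by simp [hxi])
        have h2 := (hopt i).2.2 hi
        have h3 : 0 ≤ α * (s i / Real.sqrt (G.deg i)) :=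
          mul_nonneg hα.le (div_nonneg (hs i) (Real.sqrt_nonneg _))
        have h4 := thr_nonneg (G := G) hα hρ i
        rw [WGraph.grad] at h2
        rw [Matrix.mulVec_add, Pi.add_apply] at h1
        exact mul_nonpos_of_nonneg_of_nonpos (hx0 i) (by linarith)
    have hle : x ⬝ᵥ (G.Q α *ᵥ x) ≤ 0 := Finset.sum_nonpos fun i _ => hterm i
    have hge := G.alpha_mul_le_dotProduct_Q hd hα1.le x
    have hxx : x ⬝ᵥ x = 0 := le_antisymm (by nlinarith)
      (Finset.sum_nonneg fun i _ => mul_self_nonneg _)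
    have hx : x = 0 := dotProduct_self_eq_zero.1 hxx
    intro i
    have : -q i ≤ x i := le_max_left _ _
    rw [hx] at this
    simpa using this
  refine ⟨h0, fun i => (hopt i).1, fun i hi => (hopt i).2.1 (lt_of_le_of_ne (h0 i) hi.symm)⟩

/-- The volume of the support of the minimizer is at most `1 / ρ`: the optimality conditions,
weighted with `d_i^{1/2}`, are summed over the support. -/
lemma IsOptimal.mul_vol_supp_le (h : IsOptimal G α ρ s q) (hd : ∀ i, 0 < G.deg i) (hα : 0 < α)
    (hα1 : α < 1) (hs : ∀ i, 0 ≤ s i) (hs1 : ∑ i, s i = 1) : ρ * G.vol (supp q) ≤ 1 := by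
  have hpos : ∀ i, 0 < Real.sqrt (G.deg i) := fun i => Real.sqrt_pos.2 (hd i)
  have hall : ∑ i, Real.sqrt (G.deg i) * (G.Q α *ᵥ q) i =
      α * ∑ i, Real.sqrt (G.deg i) * q i := by
    have e := G.sum_mul_deg_eq' fun i => q i / Real.sqrt (G.deg i)
    have e2 : ∀ i, G.deg i * (q i / Real.sqrt (G.deg i)) = Real.sqrt (G.deg i) * q i := fun i => by
      have := (hpos i).ne'
      nth_rewrite 1 [← Real.mul_self_sqrt (hd i).le]
      field_simp
    simp only [e2] at e
    have e3 : ∀ i, Real.sqrt (G.deg i) * (G.Q α *ᵥ q) i =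
        (1 + α) / 2 * (Real.sqrt (G.deg i) * q i) -
          (1 - α) / 2 * ∑ j, G.A i j * (q j / Real.sqrt (G.deg j)) := fun i => by
      rw [G.Q_mulVec_apply hd, mul_sub, mul_left_comm _ ((1 - α) / 2), Finset.mul_sum]
      congr 1
      · ring
      · congr 1
        refine Finset.sum_congr rfl fun j _ => ?_
        have := (hpos i).ne'
        have := (hpos j).ne'
        field_simp
    simp only [e3, Finset.sum_sub_distrib, ← Finset.mul_sum]
    rw [e]; ring
  have hall0 : 0 ≤ ∑ i, Real.sqrt (G.deg i) * (G.Q α *ᵥ q) i := by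
    rw [hall]
    exact mul_nonneg hα.le (Finset.sum_nonneg fun i _ => mul_nonneg (hpos i).le (h.nonneg i))
  have hsub : ∑ i, Real.sqrt (G.deg i) * (G.Q α *ᵥ q) i ≤
      ∑ i ∈ supp q, Real.sqrt (G.deg i) * (G.Q α *ᵥ q) i := by
    rw [← Finset.sum_add_sum_compl (supp q)]
    have : ∑ i ∈ (supp q)ᶜ, Real.sqrt (G.deg i) * (G.Q α *ᵥ q) i ≤ 0 :=
      Finset.sum_nonpos fun i hi => mul_nonpos_of_nonneg_of_nonpos (hpos i).le
        (G.Q_mulVec_nonpos_of_eq_zero hd hα1.le h.nonneg (by simpa [supp] using hi))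
    linarith
  have hterm : ∑ i ∈ supp q, Real.sqrt (G.deg i) * (G.Q α *ᵥ q) i =
      α * ∑ i ∈ supp q, s i - ρ * α * G.vol (supp q) := by
    rw [WGraph.vol, Finset.mul_sum, Finset.mul_sum, ← Finset.sum_sub_distrib]
    refine Finset.sum_congr rfl fun i hi => ?_
    have hg := h.grad_eq i (by simpa [supp] using hi)
    rw [WGraph.grad, thr, sub_eq_iff_eq_add] at hg
    rw [hg]
    have h1 := Real.mul_self_sqrt (hd i).le
    have h2 : Real.sqrt (G.deg i) * (s i / Real.sqrt (G.deg i)) = s i :=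
      mul_div_cancel₀ _ (hpos i).ne'
    calc _ = -(ρ * α * (Real.sqrt (G.deg i) * Real.sqrt (G.deg i))) +
          α * (Real.sqrt (G.deg i) * (s i / Real.sqrt (G.deg i))) := by ring
      _ = _ := by rw [h1, h2]; ring
  have hs' : ∑ i ∈ supp q, s i ≤ 1 := hs1 ▸
    Finset.sum_le_sum_of_subset_of_nonneg (Finset.subset_univ _) fun i _ _ => hs i
  have : 0 ≤ α * (1 - ρ * G.vol (supp q)) := by nlinarith
  nlinarith [nonneg_of_mul_nonneg_right this hα]

lemma IsOptimal.dotProduct_self_le (h : IsOptimal G α ρ s q) (hd : ∀ i, 0 < G.deg i) (hα : 0 < α)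
    (hα1 : α < 1) (hρ : 0 < ρ) (hs : ∀ i, 0 ≤ s i) (hs1 : ∑ i, s i = 1) {δ : ℝ} (hδ : 0 < δ)
    (hδd : ∀ i, δ ≤ G.deg i) : q ⬝ᵥ q ≤ 1 / δ := by
  have h1 := G.alpha_mul_le_dotProduct_Q hd hα1.le q
  have h2 : q ⬝ᵥ (G.Q α *ᵥ q) ≤ α * ∑ i, q i * (s i / Real.sqrt (G.deg i)) := by
    rw [Finset.mul_sum]
    refine Finset.sum_le_sum fun i _ => ?_
    by_cases hi : q i = 0
    · simp [hi]
    · have hg := h.grad_eq i hi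
      rw [WGraph.grad, sub_eq_iff_eq_add] at hg
      rw [hg]
      nlinarith [mul_nonneg (h.nonneg i) (thr_nonneg (G := G) hα hρ i)]
  have h3 : q ⬝ᵥ q ≤ ∑ i, q i * (s i / Real.sqrt (G.deg i)) :=
    le_of_mul_le_mul_left (h1.trans h2) hα
  have h4 : ∑ i, q i * (s i / Real.sqrt (G.deg i)) ≤ 1 / 2 * (q ⬝ᵥ q) + 1 / 2 * (1 / δ) := by
    have : 1 / δ = ∑ i, s i / δ := by rw [← Finset.sum_div, hs1]
    rw [this, dotProduct, Finset.mul_sum, Finset.mul_sum, ← Finset.sum_add_distrib]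
    refine Finset.sum_le_sum fun i _ => ?_
    have hsi : s i ≤ 1 := hs1 ▸ Finset.single_le_sum (fun j _ => hs j) (Finset.mem_univ i)
    have h5 : (s i / Real.sqrt (G.deg i)) ^ 2 ≤ s i / δ := by
      rw [div_pow, Real.sq_sqrt (hd i).le]
      refine div_le_div₀ (hs i) ?_ hδ (hδd i)
      nlinarith [hs i]
    nlinarith [sq_nonneg (q i - s i / Real.sqrt (G.deg i))]
  linarith

end Optimal

/-! ### The iterates -/

section Iterates

variable {n : ℕ} {G : WGraph n} {α ρ : ℝ} {s q : Fin n → ℝ}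

lemma mem_supp {x : Fin n → ℝ} {i : Fin n} : i ∈ supp x ↔ x i ≠ 0 := by simp [supp]

lemma mem_activeSet {x : Iterate n} {i : Fin n} :
    i ∈ activeSet G α ρ x ↔ thr G α ρ i ≤ x.q i - x.g i := by simp [activeSet]

lemma inflow_eq (hd : ∀ i, 0 < G.deg i) (x : Iterate n) (i : Fin n) :
    inflow G α ρ x i = (1 - α) / 2 * ∑ j, G.A i j * delta G α ρ x j /
      (Real.sqrt (G.deg i) * Real.sqrt (G.deg j)) := by
  classical
  have hi := (Real.sqrt_pos.2 (hd i)).ne'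
  rw [inflow, Finset.sum_subset (Finset.subset_univ _), Finset.mul_sum, Finset.mul_sum]
  · refine Finset.sum_congr rfl fun j _ => ?_
    have hj := (Real.sqrt_pos.2 (hd j)).ne'
    field_simp
  · intro j _ hj
    rw [Finset.mem_filter] at hj
    by_cases h : j ∈ activeSet G α ρ x
    · have hA : G.A j i = 0 := by_contra fun hA => hj ⟨h, hA⟩
      rw [G.symm i j, hA]; simp
    · rw [delta, if_neg h]; simp

lemma nextIterate_q (x : Iterate n) :
    (nextIterate G α ρ x).q = x.q + delta G α ρ x := by
  funext i
  by_cases h : i ∈ activeSet G α ρ x <;> simp [nextIterate, delta, h]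

lemma nextIterate_g (hd : ∀ i, 0 < G.deg i) (x : Iterate n) :
    (nextIterate G α ρ x).g = x.g + G.Q α *ᵥ delta G α ρ x := by
  classical
  funext i
  have hQ := G.Q_mulVec_apply hd α (delta G α ρ x) i
  rw [← inflow_eq hd] at hQ
  rw [Pi.add_apply, hQ]
  by_cases h : i ∈ activeSet G α ρ x
  · simp only [nextIterate, h, if_true, delta]; ring
  · have hδ : delta G α ρ x i = 0 := by simp [delta, h]
    by_cases h' : ∃ l ∈ activeSet G α ρ x, G.Adj l i
    · simp only [nextIterate, h, h', if_true, if_false, hδ]; ring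
    · have : inflow G α ρ x i = 0 := by
        rw [inflow, Finset.sum_eq_zero, mul_zero]
        intro l hl
        rw [Finset.mem_filter] at hl
        exact absurd ⟨l, hl⟩ h'
      simp only [nextIterate, h, h', if_false, hδ, this]; ring

/-- What holds for all iterates: they approach the optimal point `q` from below, and a node with a
positive entry has a gradient below the negative of its threshold, so that its entry never
decreases. -/
structure IsLowerIterate (G : WGraph n) (α ρ : ℝ) (s q : Fin n → ℝ) (x : Iterate n) : Prop where
  nonneg : 0 ≤ x.q
  g_le : ∀ i, 0 < x.q i → x.g i ≤ -thr G α ρ i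
  g_eq : x.g = G.grad α s x.q
  le : x.q ≤ q

namespace IsLowerIterate

variable {x : Iterate n}

lemma g_nonpos (hx : IsLowerIterate G α ρ s q x) (hd : ∀ i, 0 < G.deg i) (hα : 0 < α)
    (hα1 : α < 1) (hρ : 0 < ρ) (hs : ∀ i, 0 ≤ s i) (i : Fin n) : x.g i ≤ 0 := by
  rcases (hx.nonneg i).eq_or_lt with h | h
  · rw [hx.g_eq, WGraph.grad]
    have h1 := G.Q_mulVec_nonpos_of_eq_zero hd hα1.le hx.nonneg h.symm
    have h2 : 0 ≤ α * (s i / Real.sqrt (G.deg i)) :=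
      mul_nonneg hα.le (div_nonneg (hs i) (Real.sqrt_nonneg _))
    linarith
  · linarith [hx.g_le i h, thr_nonneg (G := G) hα hρ i]

lemma delta_nonneg (hx : IsLowerIterate G α ρ s q x) (i : Fin n) : 0 ≤ delta G α ρ x i := by
  rw [delta]
  split_ifs with h
  · rw [mem_activeSet] at h
    rcases (hx.nonneg i).eq_or_lt with h0 | h0
    · rw [← h0] at h
      simp only [Pi.zero_apply] at h
      linarith
    · linarith [hx.g_le i h0]
  · exact le_rfl

/-- A node with a positive entry exceeds its threshold strictly. -/
lemma thr_lt_of_pos (hx : IsLowerIterate G α ρ s q x) {i : Fin n} (hi : 0 < x.q i) :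
    thr G α ρ i < x.q i - x.g i := by linarith [hx.g_le i hi]

/-- A node on the boundary of the active set is not moved. -/
lemma delta_eq_zero (hx : IsLowerIterate G α ρ s q x) {i : Fin n}
    (hi : x.q i - x.g i ≤ thr G α ρ i) : delta G α ρ x i = 0 := by
  rw [delta]
  split_ifs with h
  · rw [mem_activeSet] at h
    have h0 : x.q i = 0 :=
      le_antisymm (not_lt.1 fun h0 => (hx.thr_lt_of_pos h0).not_ge hi) (hx.nonneg i)
    rw [h0] at h hi
    linarith
  · rfl

/-- Exceeding the threshold strictly is kept, and makes the entry positive. -/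
lemma next_pos (hx : IsLowerIterate G α ρ s q x) {i : Fin n}
    (hi : thr G α ρ i < x.q i - x.g i) : 0 < (nextIterate G α ρ x).q i := by
  rw [nextIterate_q, Pi.add_apply]
  rcases (hx.nonneg i).eq_or_lt with h0 | h0
  · rw [delta, if_pos (mem_activeSet.2 hi.le), ← h0]
    rw [← h0] at hi
    simp only [Pi.zero_apply] at hi ⊢
    linarith
  · exact add_pos_of_pos_of_nonneg h0 (hx.delta_nonneg i)

lemma next_le (hx : IsLowerIterate G α ρ s q x) (hq : IsOptimal G α ρ s q)
    (hd : ∀ i, 0 < G.deg i) (hα1 : α < 1) : (nextIterate G α ρ x).q ≤ q := by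
  intro i
  rw [nextIterate_q, Pi.add_apply]
  by_cases h : i ∈ activeSet G α ρ x
  · rw [delta, if_pos h, hx.g_eq]
    have h1 := G.sub_Q_mulVec_mono hd hα1.le hx.le i
    have h2 := hq.neg_thr_le i
    simp only [WGraph.grad] at h2 ⊢
    linarith
  · rw [delta, if_neg h, add_zero]; exact hx.le i

lemma next (hx : IsLowerIterate G α ρ s q x) (hq : IsOptimal G α ρ s q)
    (hd : ∀ i, 0 < G.deg i) (hα1 : α < 1) :
    IsLowerIterate G α ρ s q (nextIterate G α ρ x) where
  nonneg i := by
    rw [nextIterate_q]; exact add_nonneg (hx.nonneg i) (hx.delta_nonneg i)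
  g_le i hi := by
    -- the new gradient is the old one plus `Δ`, minus the `i`-th entry of `(I - Q) Δ ≥ 0`
    have h1 := G.sub_Q_mulVec_mono hd hα1.le (x := 0) (y := delta G α ρ x) hx.delta_nonneg i
    simp only [Matrix.mulVec_zero, Pi.zero_apply, sub_zero] at h1
    rw [nextIterate_g hd, Pi.add_apply]
    by_cases h : i ∈ activeSet G α ρ x
    · have h2 : delta G α ρ x i = -(x.g i + thr G α ρ i) := by rw [delta, if_pos h]
      linarith
    · have h2 : delta G α ρ x i = 0 := by rw [delta, if_neg h]
      rw [nextIterate_q, Pi.add_apply, h2, add_zero] at hi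
      linarith [hx.g_le i hi]
  g_eq := by
    rw [nextIterate_g hd, nextIterate_q, hx.g_eq]
    funext i
    simp only [WGraph.grad, Pi.add_apply, Matrix.mulVec_add]
    ring
  le := hx.next_le hq hd hα1

/-- Nodes above their threshold lie in the support of the optimal point. -/
lemma mem_supp_of_thr_lt (hx : IsLowerIterate G α ρ s q x) (hq : IsOptimal G α ρ s q)
    (hd : ∀ i, 0 < G.deg i) (hα1 : α < 1) {i : Fin n} (hi : thr G α ρ i < x.q i - x.g i) :
    i ∈ supp q :=
  mem_supp.2 ((hx.next_pos hi).trans_le (hx.next_le hq hd hα1 i)).ne'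

/-- One iteration contracts the squared distance to the optimal point by the factor `1 - μ`. The
new error is dominated, on the support of the optimal point, by `I - Q` applied to the old one, and
`I - Q` is positive semidefinite and at most `1 - μ` there. -/
lemma contraction (hx : IsLowerIterate G α ρ s q x) (hq : IsOptimal G α ρ s q)
    (hd : ∀ i, 0 < G.deg i) (hα : 0 < α) (hα1 : α < 1)
    (hvol : G.vol (supp q) ≤ G.vol Finset.univ / 2) :
    (q - (nextIterate G α ρ x).q) ⬝ᵥ (q - (nextIterate G α ρ x).q) ≤
      (1 - G.mu α (supp q)) * ((q - x.q) ⬝ᵥ (q - x.q)) := by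
  have hle := hx.next_le hq hd hα1
  have hnn := (hx.next hq hd hα1).nonneg
  set e := q - x.q with he
  set e' := q - (nextIterate G α ρ x).q with he'
  have supp_sub : ∀ y : Fin n → ℝ, 0 ≤ y → y ≤ q → supp (q - y) ⊆ supp q := fun y h0 h1 i hi => by
    rw [mem_supp] at hi ⊢
    intro h
    have h2 := h0 i
    have h3 := h1 i
    rw [h] at h3
    exact hi (by simp [h, le_antisymm h3 h2])
  have hdom : ∀ i, e' i * e' i ≤ e' i * (e i - (G.Q α *ᵥ e) i) := fun i => by
    have h0 : 0 ≤ e' i := sub_nonneg.2 (hle i)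
    by_cases hi : q i = 0
    · have : e' i = 0 := le_antisymm (by
        have := hnn i
        simp only [he', Pi.sub_apply, Pi.zero_apply] at this ⊢; linarith) h0
      simp [this]
    · refine mul_le_mul_of_nonneg_left ?_ h0
      have hg := hq.grad_eq i hi
      have hgx : x.g i = G.grad α s x.q i := by rw [hx.g_eq]
      rw [he, he', Matrix.mulVec_sub, nextIterate_q]
      simp only [Pi.sub_apply, Pi.add_apply]
      simp only [WGraph.grad] at hg hgx
      by_cases h : i ∈ activeSet G α ρ x
      · rw [delta, if_pos h]; linarith
      · rw [delta, if_neg h]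
        rw [mem_activeSet, not_le] at h
        have := hx.nonneg i
        simp only [Pi.zero_apply] at this
        linarith
  have h1 : e' ⬝ᵥ e' ≤ e' ⬝ᵥ e - e' ⬝ᵥ (G.Q α *ᵥ e) := by
    rw [← dotProduct_sub]
    exact Finset.sum_le_sum fun i _ => hdom i
  have h2 := G.dotProduct_Q_mulVec_le hd hα1.le (e' - e)
  have h3 := G.mu_mul_le_dotProduct_Q hd hα1.le hvol (supp_sub _ hx.nonneg hx.le)
  have h4 := G.mu_mul_le_dotProduct_Q hd hα1.le hvol (supp_sub _ hnn hle)
  rw [← he] at h3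
  rw [← he'] at h4
  rw [Matrix.mulVec_sub] at h2
  simp only [sub_dotProduct, dotProduct_sub] at h2
  rw [G.dotProduct_Q_mulVec_comm α e e', dotProduct_comm e e'] at h2
  have h5 : 0 ≤ e' ⬝ᵥ e' := Finset.sum_nonneg fun i _ => mul_self_nonneg _
  have hμ : 0 < G.mu α (supp q) := hα.trans_le (G.le_mu hα1.le _)
  nlinarith [mul_nonneg hμ.le h5]

/-- Close to the optimal point the termination criterion holds. -/
lemma terminates (hx : IsLowerIterate G α ρ s q x) (hq : IsOptimal G α ρ s q)
    (hd : ∀ i, 0 < G.deg i) (hα : 0 < α) (hα1 : α < 1) (hρ : 0 < ρ) (hs : ∀ i, 0 ≤ s i) {ε δ : ℝ}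
    (hε : 0 < ε) (hδd : ∀ i, δ ≤ G.deg i)
    (h : (q - x.q) ⬝ᵥ (q - x.q) ≤ ε ^ 2 * ρ ^ 2 * α ^ 2 * δ) : Terminates G α ρ ε x.g := by
  rw [Terminates, pi_norm_le_iff_of_nonneg (by positivity)]
  intro i
  have hpos : 0 < Real.sqrt (G.deg i) := Real.sqrt_pos.2 (hd i)
  have h1 := G.sq_Q_mulVec_le hd hα.le hα1.le (q - x.q) i
  have h2 : (G.Q α *ᵥ (q - x.q)) i ≤ ε * ρ * α * Real.sqrt (G.deg i) := by
    refine le_of_sq_le_sq (h1.trans (h.trans ?_)) (by positivity)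
    rw [mul_pow, mul_pow, mul_pow, Real.sq_sqrt (hd i).le]
    exact mul_le_mul_of_nonneg_left (hδd i) (by positivity)
  have h3 := hq.neg_thr_le i
  have h4 : x.g i = G.grad α s x.q i := by rw [hx.g_eq]
  rw [Matrix.mulVec_sub, Pi.sub_apply] at h2
  rw [WGraph.grad] at h3 h4
  rw [thr] at h3
  rw [Real.norm_eq_abs, abs_div, abs_of_pos hpos, div_le_iff₀ hpos,
    abs_of_nonpos (hx.g_nonpos hd hα hα1 hρ hs i), h4]
  linarith

/-- The nodes that do not exceed their thresholds never violate the termination criterion, so that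
it may be tested on the others alone. -/
lemma terminates_iff (hx : IsLowerIterate G α ρ s q x) (hd : ∀ i, 0 < G.deg i) (hα : 0 < α)
    (hα1 : α < 1) (hρ : 0 < ρ) (hs : ∀ i, 0 ≤ s i) {ε : ℝ} (hε : 0 < ε) :
    Terminates G α ρ ε x.g ↔ ∀ i, thr G α ρ i < x.q i - x.g i →
      |x.g i| / Real.sqrt (G.deg i) ≤ (1 + ε) * ρ * α := by
  rw [Terminates, pi_norm_le_iff_of_nonneg (by positivity)]
  have habs : ∀ i, ‖x.g i / Real.sqrt (G.deg i)‖ = |x.g i| / Real.sqrt (G.deg i) := fun i => by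
    rw [Real.norm_eq_abs, abs_div, abs_of_nonneg (Real.sqrt_nonneg _)]
  simp only [habs]
  refine ⟨fun h i _ => h i, fun h i => ?_⟩
  by_cases hi : thr G α ρ i < x.q i - x.g i
  · exact h i hi
  · have h1 := hx.nonneg i
    have hpos : 0 < Real.sqrt (G.deg i) := Real.sqrt_pos.2 (hd i)
    simp only [Pi.zero_apply] at h1
    rw [abs_of_nonpos (hx.g_nonpos hd hα hα1 hρ hs i), div_le_iff₀ hpos]
    have h2 : 0 ≤ ε * (ρ * α * Real.sqrt (G.deg i)) := by positivity
    rw [thr] at hi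
    linarith

end IsLowerIterate

lemma iterate_succ (k : ℕ) :
    iterate G α ρ s (k + 1) = nextIterate G α ρ (iterate G α ρ s k) :=
  Function.iterate_succ_apply' _ _ _

lemma isLowerIterate_iterate (hq : IsOptimal G α ρ s q) (hd : ∀ i, 0 < G.deg i) (hα1 : α < 1)
    (k : ℕ) : IsLowerIterate G α ρ s q (iterate G α ρ s k) := by
  induction k with
  | zero =>
    refine ⟨le_rfl, fun i hi => absurd hi (lt_irrefl _), ?_, hq.nonneg⟩
    funext i
    change -α * (s i / Real.sqrt (G.deg i)) = (G.Q α *ᵥ 0) i - α * (s i / Real.sqrt (G.deg i))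
    simp
  | succ k ih => rw [iterate_succ]; exact ih.next hq hd hα1

/-- Linear convergence of the iterates. -/
lemma dotProduct_error_le (hq : IsOptimal G α ρ s q) (hd : ∀ i, 0 < G.deg i) (hα : 0 < α)
    (hα1 : α < 1) (hvol : G.vol (supp q) ≤ G.vol Finset.univ / 2) (k : ℕ) :
    (q - (iterate G α ρ s k).q) ⬝ᵥ (q - (iterate G α ρ s k).q) ≤
      Real.exp (-(G.mu α (supp q) * k)) * (q ⬝ᵥ q) := by
  induction k with
  | zero =>
    have : q - (iterate G α ρ s 0).q = q := sub_zero q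
    rw [this]; simp
  | succ k ih =>
    rw [iterate_succ]
    refine ((isLowerIterate_iterate hq hd hα1 k).contraction hq hd hα hα1 hvol).trans ?_
    have h1 : 1 - G.mu α (supp q) ≤ Real.exp (-G.mu α (supp q)) := by
      linarith [Real.add_one_le_exp (-G.mu α (supp q))]
    have h2 : Real.exp (-(G.mu α (supp q) * (k + 1 : ℕ))) =
        Real.exp (-G.mu α (supp q)) * Real.exp (-(G.mu α (supp q) * k)) := by
      rw [← Real.exp_add]; congr 1; push_cast; ring
    rw [h2, mul_assoc]
    exact mul_le_mul h1 ih (Finset.sum_nonneg fun i _ => mul_self_nonneg _) (Real.exp_pos _).le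

lemma mu_le_one (hd : ∀ i, 0 < G.deg i) (hα1 : α < 1)
    (hvol : G.vol (supp q) ≤ G.vol Finset.univ / 2) (hne : (supp q).Nonempty) :
    G.mu α (supp q) ≤ 1 := by
  have h1 := G.mu_mul_le_dotProduct_Q hd hα1.le hvol (Finset.Subset.refl (supp q))
  have h2 := G.dotProduct_Q_mulVec_le hd hα1.le q
  have h3 : 0 < q ⬝ᵥ q := by
    obtain ⟨i, hi⟩ := hne
    exact Finset.sum_pos' (fun j _ => mul_self_nonneg _)
      ⟨i, Finset.mem_univ i, mul_self_pos.2 (mem_supp.1 hi)⟩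
  exact le_of_mul_le_mul_right (by linarith) h3

/-- With `L = log (2 / (ε² ρ² α² δ))`, the solver needs at most `2 L / μ + 1` iterations. -/
lemma exists_stopsAfter (hq : IsOptimal G α ρ s q) (hd : ∀ i, 0 < G.deg i) (hα : 0 < α)
    (hα1 : α < 1) (hρ : 0 < ρ) (hρ1 : ρ ≤ 1) (hs : ∀ i, 0 ≤ s i) (hs1 : ∑ i, s i = 1)
    (hvol : G.vol (supp q) ≤ G.vol Finset.univ / 2) {ε δ : ℝ} (hε : 0 < ε) (hε1 : ε < 1)
    (hδ : 0 < δ) (hδd : ∀ i, δ ≤ G.deg i)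
    (hL : 0 ≤ Real.log (2 / (ε ^ 2 * ρ ^ 2 * α ^ 2 * δ))) :
    ∃ T, StopsAfter G α ρ ε s T ∧
      (T : ℝ) ≤ 2 * Real.log (2 / (ε ^ 2 * ρ ^ 2 * α ^ 2 * δ)) / G.mu α (supp q) + 1 := by
  classical
  set L := Real.log (2 / (ε ^ 2 * ρ ^ 2 * α ^ 2 * δ)) with hLdef
  set B := ε ^ 2 * ρ ^ 2 * α ^ 2 with hB
  have hμ : 0 < G.mu α (supp q) := hα.trans_le (G.le_mu hα1.le _)
  have hB0 : 0 < B := by positivity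
  have hB1 : B ≤ 1 := by
    have h : (ε * ρ * α) ^ 2 ≤ 1 := by
      refine pow_le_one₀ (by positivity) ?_
      exact mul_le_one₀ (mul_le_one₀ hε1.le hρ.le hρ1) hα.le hα1.le
    rw [hB]; nlinarith
  -- `‖q‖² ≤ 1 / δ` is to be brought down to `B δ`; the factor `exp (-2 L) = (B δ / 2)²` suffices,
  -- since `B ≤ 1`
  let k := ⌈2 * L / G.mu α (supp q)⌉₊
  have hk : 2 * L ≤ G.mu α (supp q) * k := by
    have := Nat.le_ceil (2 * L / G.mu α (supp q))
    rw [div_le_iff₀ hμ] at this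
    linarith
  have hterm : Terminates G α ρ ε (iterate G α ρ s k).g := by
    refine (isLowerIterate_iterate hq hd hα1 k).terminates hq hd hα hα1 hρ hs hε hδd ?_
    have h1 := dotProduct_error_le (s := s) hq hd hα hα1 hvol k
    have h2 := hq.dotProduct_self_le hd hα hα1 hρ hs hs1 hδ hδd
    have h3 : Real.exp (-(G.mu α (supp q) * k)) ≤ (B * δ / 2) ^ 2 := by
      refine (Real.exp_le_exp.2 (neg_le_neg hk)).trans (le_of_eq ?_)
      have : -(2 * L) = -L + -L := by ring
      rw [this, Real.exp_add, Real.exp_neg, hLdef, Real.exp_log (by positivity), inv_div, sq]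
    calc _ ≤ _ := h1
      _ ≤ (B * δ / 2) ^ 2 * (1 / δ) := mul_le_mul h3 h2
          (Finset.sum_nonneg fun i _ => mul_self_nonneg _) (sq_nonneg _)
      _ = B * δ * (B / 4) := by field_simp; norm_num
      _ ≤ B * δ * 1 := mul_le_mul_of_nonneg_left (by linarith) (by positivity)
      _ = B * δ := mul_one _
  have hex : ∃ T, Terminates G α ρ ε (iterate G α ρ s T).g := ⟨k, hterm⟩
  refine ⟨Nat.find hex, ⟨Nat.find_spec hex, fun j hj => Nat.find_min hex hj⟩, ?_⟩
  have h1 : (Nat.find hex : ℝ) ≤ k := by exact_mod_cast Nat.find_min' hex hterm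
  have h2 : (k : ℝ) < 2 * L / G.mu α (supp q) + 1 := Nat.ceil_lt_add_one (by positivity)
  linarith

end Iterates

/-! ### Semantics and cost of the program -/

attribute [ext] Mem

section Semantics

variable {n : ℕ} (G : WGraph n) (α ρ : ℝ)

lemma run_seq (c₁ c₂ : Cmd n) (m : Mem n) : (Cmd.seq c₁ c₂).run G m = c₂.run G (c₁.run G m) := by
  rw [Cmd.run]

lemma run_forActive (c : Fin n → Cmd n) (m : Mem n) : (Cmd.forActive c).run G m =
    m.act.foldl (fun m' i => (c i).run G (m'.tick 1)) (m.tick 1) := by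
  rw [Cmd.run]

lemma run_forNbr (i : Fin n) (c : Fin n → Cmd n) (m : Mem n) : (Cmd.forNbr i c).run G m =
    (G.nbrs i).foldl (fun m' j => (c j).run G (m'.tick 1)) (m.tick 1) := by
  rw [Cmd.run]

lemma mem_nbrs {i j : Fin n} : j ∈ G.nbrs i ↔ G.A i j ≠ 0 := by
  classical
  simp only [WGraph.nbrs, List.mem_filter, List.mem_finRange, true_and]
  exact decide_eq_true_iff

lemma nodup_nbrs (i : Fin n) : (G.nbrs i).Nodup := by
  classical
  exact (List.nodup_finRange n).filter _

lemma eval_thrExpr (m : Mem n) (i : Fin n) : (thrExpr α ρ i).eval G m = thr G α ρ i := rfl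

open Classical in
lemma foldl_test (c : ℝ) (l : List (Fin n)) (m : Mem n) : ∃ t ≤ m.steps + 9 * l.length,
    l.foldl (fun m' i => (Cmd.ifLt (.const c) (.div (.abs (.read .g i)) (.sqrt (.deg i)))
      (.putFlag true)).run G (m'.tick 1)) m =
    { m with
      flag := m.flag || decide (∃ i ∈ l, c < |m.g i| / Real.sqrt (G.deg i))
      steps := t } := by
  induction l generalizing m with
  | nil => exact ⟨m.steps, by simp, by simp⟩
  | cons a l ih =>
    rw [List.foldl_cons]
    obtain ⟨t, ht, h⟩ := ih ((Cmd.ifLt (.const c) (.div (.abs (.read .g a)) (.sqrt (.deg a)))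
      (.putFlag true)).run G (m.tick 1))
    refine ⟨t, ht.trans ?_, h.trans ?_⟩
    · by_cases ha : c < |m.g a| / Real.sqrt (G.deg a) <;>
        simp [Cmd.run, Expr.eval, Expr.cost, Mem.tick, Mem.get, ha] <;> omega
    · by_cases ha : c < |m.g a| / Real.sqrt (G.deg a) <;>
        simp [Cmd.run, Expr.eval, Mem.tick, Mem.get, ha]

lemma foldl_updateIterate (l : List (Fin n)) (hl : l.Nodup) (m : Mem n) :
    l.foldl (fun m' i => (Cmd.seq
      (.write .d i (.sub (.const 0) (.add (.read .g i) (thrExpr α ρ i))))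
      (.write .q i (.add (.read .q i) (.read .d i)))).run G (m'.tick 1)) m =
    { m with
      q := fun i => if i ∈ l then m.q i + -(m.g i + thr G α ρ i) else m.q i
      d := fun i => if i ∈ l then -(m.g i + thr G α ρ i) else m.d i
      steps := m.steps + 14 * l.length } := by
  induction l generalizing m with
  | nil => simp
  | cons a l ih =>
    obtain ⟨ha, hl⟩ := List.nodup_cons.1 hl
    rw [List.foldl_cons, ih hl]
    ext i
    · by_cases hi : i = a
      · subst hi; simp [Cmd.run, Expr.eval, Mem.tick, Mem.get, Mem.set, eval_thrExpr, ha]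
      · simp [Cmd.run, Mem.tick, Mem.set, hi]
    · simp [Cmd.run, Mem.tick, Mem.set]
    · by_cases hi : i = a
      · subst hi; simp [Cmd.run, Expr.eval, Mem.tick, Mem.get, Mem.set, eval_thrExpr, ha]
      · simp [Cmd.run, Mem.tick, Mem.set, hi]
    · simp [Cmd.run, Mem.tick, Mem.set]
    · simp [Cmd.run, Mem.tick, Mem.set]
    · simp [Cmd.run, Mem.tick, Mem.set]
    · simp [Cmd.run, Mem.tick, Mem.set]
    · simp [Cmd.run, Expr.cost, thrExpr, Mem.tick, Mem.set]; omega

lemma foldl_resetGradient (l : List (Fin n)) (hl : l.Nodup) (m : Mem n) :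
    l.foldl (fun m' i => (Cmd.write .g i (.sub (.sub (.const 0) (thrExpr α ρ i))
        (.mul (.const ((1 - α) / 2)) (.read .d i)))).run G (m'.tick 1)) m =
    { m with
      g := fun i => if i ∈ l then 0 - thr G α ρ i - (1 - α) / 2 * m.d i else m.g i
      steps := m.steps + 12 * l.length } := by
  induction l generalizing m with
  | nil => simp
  | cons a l ih =>
    obtain ⟨ha, hl⟩ := List.nodup_cons.1 hl
    rw [List.foldl_cons, ih hl]
    ext i
    · simp [Cmd.run, Mem.tick, Mem.set]
    · by_cases hi : i = a
      · subst hi; simp [Cmd.run, Expr.eval, Mem.tick, Mem.get, Mem.set, eval_thrExpr, ha]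
      · simp [Cmd.run, Mem.tick, Mem.set, hi]
    · simp [Cmd.run, Mem.tick, Mem.set]
    · simp [Cmd.run, Mem.tick, Mem.set]
    · simp [Cmd.run, Mem.tick, Mem.set]
    · simp [Cmd.run, Mem.tick, Mem.set]
    · simp [Cmd.run, Mem.tick, Mem.set]
    · simp [Cmd.run, Expr.cost, thrExpr, Mem.tick, Mem.set]; omega

/-- What the node `l` with update `v l` contributes to the gradient at `j`. -/
noncomputable def contribution (v : Fin n → ℝ) (j l : Fin n) : ℝ :=
  (1 - α) / (2 * Real.sqrt (G.deg j)) * (G.A j l * v l / Real.sqrt (G.deg l))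

/-- The command that sends the contribution of `l` to `j`. -/
noncomputable def sendCmd (l j : Fin n) : Cmd n :=
  .write .g j (.sub (.read .g j)
    (.mul (.div (.const (1 - α)) (.mul (.const 2) (.sqrt (.deg j))))
      (.div (.mul (.wt j l) (.read .d l)) (.sqrt (.deg l)))))

lemma foldl_send (l : Fin n) (N : List (Fin n)) (hN : N.Nodup) (m : Mem n) :
    N.foldl (fun m' j => (sendCmd α l j).run G (m'.tick 1)) m =
    { m with
      g := fun j => if j ∈ N then m.g j - contribution G α m.d j l else m.g j
      steps := m.steps + 17 * N.length } := by
  induction N generalizing m with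
  | nil => simp
  | cons a N ih =>
    obtain ⟨ha, hN⟩ := List.nodup_cons.1 hN
    rw [List.foldl_cons, ih hN]
    ext i
    · simp [sendCmd, Cmd.run, Mem.tick, Mem.set]
    · by_cases hi : i = a
      · subst hi
        simp [sendCmd, Cmd.run, Expr.eval, Mem.tick, Mem.get, Mem.set, contribution, ha]
      · simp [sendCmd, Cmd.run, Mem.tick, Mem.set, contribution, hi]
    · simp [sendCmd, Cmd.run, Mem.tick, Mem.set]
    · simp [sendCmd, Cmd.run, Mem.tick, Mem.set]
    · simp [sendCmd, Cmd.run, Mem.tick, Mem.set]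
    · simp [sendCmd, Cmd.run, Mem.tick, Mem.set]
    · simp [sendCmd, Cmd.run, Mem.tick, Mem.set]
    · simp [sendCmd, Cmd.run, Expr.cost, Mem.tick, Mem.set]; omega

lemma run_forNbr_send (l : Fin n) (m : Mem n) : (Cmd.forNbr l (sendCmd α l)).run G m =
    { m with
      g := fun j => m.g j - contribution G α m.d j l
      steps := m.steps + (1 + 17 * (G.nbrs l).length) } := by
  rw [run_forNbr, foldl_send G α l _ (nodup_nbrs G l)]
  ext j
  · rfl
  · by_cases hj : j ∈ G.nbrs l
    · simp [hj, Mem.tick]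
    · have h0 : G.A j l = 0 := by
        rw [G.symm]; exact not_not.1 (mt (mem_nbrs G).2 hj)
      simp [hj, Mem.tick, contribution, h0]
  all_goals try rfl
  simp [Mem.tick]; omega

lemma foldl_sendAll (L : List (Fin n)) (m : Mem n) :
    L.foldl (fun m' l => (Cmd.forNbr l (sendCmd α l)).run G (m'.tick 1)) m =
    { m with
      g := fun j => m.g j - (L.map (contribution G α m.d j)).sum
      steps := m.steps + (2 * L.length + 17 * (L.map fun l => (G.nbrs l).length).sum) } := by
  induction L generalizing m with
  | nil => simp
  | cons a L ih =>
    rw [List.foldl_cons, ih, run_forNbr_send]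
    simp only [Mem.tick, List.map_cons, List.sum_cons, List.length_cons, Mem.mk.injEq,
      true_and]
    refine ⟨funext fun j => by ring, by ring⟩

/-- The memory is consistent when the list `act` has no repetitions and `mark` is its indicator
array. -/
def Consistent (m : Mem n) : Prop := m.act.Nodup ∧ ∀ i, m.mark i = true ↔ i ∈ m.act

/-- The command that puts `j` on the list `act` if it exceeds its threshold. -/
noncomputable def visitCmd (j : Fin n) : Cmd n :=
  .ifUnmarked j (.ifLt (thrExpr α ρ j) (.sub (.read .q j) (.read .g j)) (.activate j))

/-- `m'` arises from `m` within `c` steps by adding to the list `act` those nodes with `P` that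
exceed their thresholds. -/
def Extends (P : Fin n → Prop) (c : ℕ) (m m' : Mem n) : Prop :=
  m' = { m with act := m'.act, mark := m'.mark, steps := m'.steps } ∧ Consistent m' ∧
    (∀ i, i ∈ m'.act ↔ i ∈ m.act ∨ P i ∧ thr G α ρ i < m.q i - m.g i) ∧ m'.steps ≤ m.steps + c

variable {G α ρ} in
lemma Extends.trans {P P' : Fin n → Prop} {c c' : ℕ} {m m' m'' : Mem n}
    (h : Extends G α ρ P c m m') (h' : Extends G α ρ P' c' m' m'') :
    Extends G α ρ (fun i => P i ∨ P' i) (c + c') m m'' := by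
  obtain ⟨h1, _, h3, h4⟩ := h
  obtain ⟨h1', h2', h3', h4'⟩ := h'
  have hq : m'.q = m.q := by rw [h1]
  have hg : m'.g = m.g := by rw [h1]
  refine ⟨?_, h2', fun i => ?_, by omega⟩
  · rw [h1', h1]
  · rw [h3', h3, hq, hg]; tauto

variable {G α ρ} in
lemma Extends.congr {P P' : Fin n → Prop} {c c' : ℕ} {m m' : Mem n}
    (h : Extends G α ρ P c m m') (hP : ∀ i, P i ↔ P' i) (hc : c ≤ c') :
    Extends G α ρ P' c' m m' :=
  ⟨h.1, h.2.1, fun i => by rw [h.2.2.1, hP], h.2.2.2.trans (by omega)⟩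

lemma extends_tick {m : Mem n} (hm : Consistent m) :
    Extends G α ρ (fun _ => False) 1 m (m.tick 1) :=
  ⟨rfl, hm, fun i => by simp [Mem.tick], le_rfl⟩

lemma extends_visit (j : Fin n) {m : Mem n} (hm : Consistent m) :
    Extends G α ρ (fun i => i = j) 10 m ((visitCmd α ρ j).run G m) := by
  by_cases hj : m.mark j = true
  · have hja := (hm.2 j).1 hj
    have e : (visitCmd α ρ j).run G m = m.tick 1 := by simp [visitCmd, Cmd.run, hj]
    rw [e]
    refine ⟨rfl, hm, fun i => ⟨Or.inl, ?_⟩, by simp [Mem.tick]⟩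
    rintro (h | ⟨rfl, -⟩)
    exacts [h, hja]
  · have hja := mt (hm.2 j).2 hj
    by_cases h : thr G α ρ j < m.q j - m.g j
    · have e : (visitCmd α ρ j).run G m = { m with
          act := j :: m.act
          mark := Function.update m.mark j true
          steps := m.steps + 10 } := by
        have h' : ρ * α * Real.sqrt (G.deg j) < m.q j - m.g j := h
        simp [visitCmd, Cmd.run, hj, Mem.tick, Expr.eval, Expr.cost, thrExpr, Mem.get, h']
      rw [e]
      refine ⟨rfl, ⟨List.nodup_cons.2 ⟨hja, hm.1⟩, fun i => ?_⟩, fun i => ?_, by simp⟩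
      · by_cases hi : i = j
        · simp [hi]
        · simp [hi, hm.2 i]
      · simp only [List.mem_cons]
        constructor
        · rintro (rfl | hi)
          exacts [Or.inr ⟨rfl, h⟩, Or.inl hi]
        · rintro (hi | ⟨rfl, -⟩)
          exacts [Or.inr hi, Or.inl rfl]
    · have e : (visitCmd α ρ j).run G m = { m with steps := m.steps + 9 } := by
        have h' : ¬ ρ * α * Real.sqrt (G.deg j) < m.q j - m.g j := h
        simp [visitCmd, Cmd.run, hj, Mem.tick, Expr.eval, Expr.cost, thrExpr, Mem.get, h']
      rw [e]
      refine ⟨rfl, hm, fun i => ⟨Or.inl, ?_⟩, by simp⟩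
      rintro (hi | ⟨rfl, hi⟩)
      exacts [hi, absurd hi h]

/-- Loops over commands that extend the list `act` do so as well. -/
lemma extends_foldl {c : Fin n → Cmd n} {P : Fin n → Fin n → Prop} {t : Fin n → ℕ}
    (hc : ∀ j m, Consistent m → Extends G α ρ (P j) (t j) m ((c j).run G m))
    (l : List (Fin n)) {m : Mem n} (hm : Consistent m) :
    Extends G α ρ (fun i => ∃ j ∈ l, P j i) (l.length + (l.map t).sum) m
      (l.foldl (fun m' j => (c j).run G (m'.tick 1)) m) := by
  induction l generalizing m with
  | nil => exact ⟨rfl, hm, fun i => by simp, by simp⟩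
  | cons a l ih =>
    rw [List.foldl_cons]
    have h1 := extends_tick G α ρ hm
    have h2 := h1.trans (hc a _ h1.2.1)
    refine (h2.trans (ih h2.2.1)).congr (fun i => by simp) ?_
    simp only [List.length_cons, List.map_cons, List.sum_cons]
    omega

lemma run_updateActive {m : Mem n} (hm : Consistent m) :
    Extends G α ρ (fun i => ∃ l ∈ m.act, i ∈ G.nbrs l)
      (1 + 2 * m.act.length + 11 * (m.act.map fun l => (G.nbrs l).length).sum) m
      ((updateActiveCmd α ρ).run G m) := by
  have hin : ∀ l m, Consistent m → Extends G α ρ (fun i => i ∈ G.nbrs l)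
      (1 + 11 * (G.nbrs l).length) m ((Cmd.forNbr l (visitCmd α ρ)).run G m) := by
    intro l m hm
    rw [run_forNbr]
    have h1 := extends_tick G α ρ hm
    refine (h1.trans (extends_foldl G α ρ (fun j _ h => extends_visit G α ρ j h) (G.nbrs l)
      h1.2.1)).congr (fun i => by simp) ?_
    simp; omega
  have e : (updateActiveCmd α ρ).run G m =
      (Cmd.forActive fun l => Cmd.forNbr l (visitCmd α ρ)).run G m := rfl
  rw [e, run_forActive]
  have h1 := extends_tick G α ρ hm
  refine (h1.trans (extends_foldl G α ρ hin m.act h1.2.1)).congr (fun i => by simp) ?_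
  have : (m.act.map fun l => 1 + 11 * (G.nbrs l).length).sum =
      m.act.length + 11 * (m.act.map fun l => (G.nbrs l).length).sum := by
    induction m.act with
    | nil => rfl
    | cons a l ih => simp only [List.map_cons, List.sum_cons, ih, List.length_cons]; ring
  omega

lemma foldl_return (l : List (Fin n)) (m : Mem n) :
    l.foldl (fun m' i => (Cmd.write .out i
      (.mul (.sqrt (.deg i)) (.read .q i))).run G (m'.tick 1)) m =
    { m with
      out := fun i => if i ∈ l then Real.sqrt (G.deg i) * m.q i else m.out i
      steps := m.steps + 6 * l.length } := by
  induction l generalizing m with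
  | nil => simp
  | cons a l ih =>
    rw [List.foldl_cons, ih]
    ext i
    · simp [Cmd.run, Mem.tick, Mem.set]
    · simp [Cmd.run, Mem.tick, Mem.set]
    · simp [Cmd.run, Mem.tick, Mem.set]
    · by_cases hi : i = a
      · subst hi; simp [Cmd.run, Expr.eval, Mem.tick, Mem.get, Mem.set]
      · simp [Cmd.run, Mem.tick, Mem.set, hi]
    · simp [Cmd.run, Mem.tick, Mem.set]
    · simp [Cmd.run, Mem.tick, Mem.set]
    · simp [Cmd.run, Mem.tick, Mem.set]
    · simp [Cmd.run, Expr.cost, Mem.tick, Mem.set]; omega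

end Semantics

/-! ### The program follows the iterates -/

section Simulation

variable {n : ℕ} {G : WGraph n} {α ρ : ℝ} {s q : Fin n → ℝ}

/-- The memory `m` holds the iterate `x`, and `act` lists the nodes above their thresholds. -/
structure Represents (G : WGraph n) (α ρ : ℝ) (m : Mem n) (x : Iterate n) : Prop where
  q_eq : m.q = x.q
  g_eq : m.g = x.g
  out_eq : m.out = 0
  consistent : Consistent m
  mem_act : ∀ i, i ∈ m.act ↔ thr G α ρ i < x.q i - x.g i

variable {m : Mem n} {x : Iterate n}

lemma represents_init : Represents G α ρ (initMem G α ρ s) (iterate G α ρ s 0) := by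
  classical
  have hmem : ∀ i, i ∈ (initMem G α ρ s).act ↔
      thr G α ρ i < (initIterate G α s).q i - (initIterate G α s).g i := fun i => by
    simp [initMem]
  refine ⟨rfl, rfl, rfl, ⟨(List.nodup_finRange n).filter _, fun i => ?_⟩, hmem⟩
  rw [hmem]
  simp [initMem]

/-- The sum of the lengths of the adjacency lists of `act`. -/
noncomputable def nbrCount (G : WGraph n) (m : Mem n) : ℕ :=
  (m.act.map fun l => (G.nbrs l).length).sum

lemma Represents.act_toFinset_subset (hm : Represents G α ρ m x)
    (hx : IsLowerIterate G α ρ s q x) (hq : IsOptimal G α ρ s q) (hd : ∀ i, 0 < G.deg i)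
    (hα1 : α < 1) : m.act.toFinset ⊆ supp q := fun i hi =>
  hx.mem_supp_of_thr_lt hq hd hα1 ((hm.mem_act i).1 (List.mem_toFinset.1 hi))

lemma Represents.length_le (hm : Represents G α ρ m x) (hx : IsLowerIterate G α ρ s q x)
    (hq : IsOptimal G α ρ s q) (hd : ∀ i, 0 < G.deg i) (hα1 : α < 1) :
    m.act.length ≤ (supp q).card := by
  rw [← List.toFinset_card_of_nodup hm.consistent.1]
  exact Finset.card_le_card (hm.act_toFinset_subset hx hq hd hα1)

lemma Represents.nbrCount_le (hm : Represents G α ρ m x) (hx : IsLowerIterate G α ρ s q x)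
    (hq : IsOptimal G α ρ s q) (hd : ∀ i, 0 < G.deg i) (hα1 : α < 1) :
    nbrCount G m ≤ G.volHat (supp q) := by
  rw [nbrCount, ← List.sum_toFinset _ hm.consistent.1]
  exact Finset.sum_le_sum_of_subset (hm.act_toFinset_subset hx hq hd hα1)

lemma Represents.tick (hm : Represents G α ρ m x) (c : ℕ) : Represents G α ρ (m.tick c) x :=
  ⟨hm.q_eq, hm.g_eq, hm.out_eq, hm.consistent, hm.mem_act⟩

lemma Represents.run_test (hm : Represents G α ρ m x) (hx : IsLowerIterate G α ρ s q x)
    (hd : ∀ i, 0 < G.deg i) (hα : 0 < α) (hα1 : α < 1) (hρ : 0 < ρ) (hs : ∀ i, 0 ≤ s i) {ε : ℝ}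
    (hε : 0 < ε) :
    Represents G α ρ ((testCmd α ρ ε).run G m) x ∧
      (((testCmd α ρ ε).run G m).flag = false ↔ Terminates G α ρ ε x.g) ∧
      ((testCmd α ρ ε).run G m).steps ≤ m.steps + 2 + 9 * m.act.length := by
  classical
  obtain ⟨t, ht, h⟩ := foldl_test G ((1 + ε) * ρ * α) ((Cmd.putFlag false).run G m).act
    (((Cmd.putFlag false).run G m).tick 1)
  rw [testCmd, run_seq, run_forActive, h]
  refine ⟨⟨hm.q_eq, hm.g_eq, hm.out_eq, hm.consistent, hm.mem_act⟩, ?_, ?_⟩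
  · rw [hx.terminates_iff hd hα hα1 hρ hs hε]
    simp only [Cmd.run, Mem.tick, hm.g_eq, Bool.false_or, decide_eq_false_iff_not, not_exists,
      not_and, not_lt, hm.mem_act]
  · simpa [Cmd.run, Mem.tick, add_assoc] using ht

/-- One pass of the program through the loop body is one iteration. Sending the contributions of the
listed nodes alone yields the full product `Q Δ`, and a node can newly exceed its threshold only if
it has a listed neighbour, so that the neighbours are the only candidates for the list. -/
lemma Represents.run_body (hm : Represents G α ρ m x) (hx : IsLowerIterate G α ρ s q x)
    (hq : IsOptimal G α ρ s q) (hd : ∀ i, 0 < G.deg i) (hα1 : α < 1) :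
    Represents G α ρ ((bodyCmd α ρ).run G m) (nextIterate G α ρ x) ∧
      ((bodyCmd α ρ).run G m).steps ≤ m.steps + 4 + 30 * m.act.length + 28 * nbrCount G m := by
  have hnd := hm.consistent.1
  -- on `act`, `d` receives the update `Δ`; on all other nodes `Δ` vanishes
  have hδ_in : ∀ i, i ∈ m.act → delta G α ρ x i = -(x.g i + thr G α ρ i) := fun i hi => by
    rw [delta, if_pos (mem_activeSet.2 ((hm.mem_act i).1 hi).le)]
  have hδ_out : ∀ i, i ∉ m.act → delta G α ρ x i = 0 := fun i hi =>
    hx.delta_eq_zero (not_lt.1 (mt (hm.mem_act i).2 hi))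
  have hnext := hx.next hq hd hα1
  obtain ⟨d, hd_in, h1⟩ : ∃ d : Fin n → ℝ, (∀ i, i ∈ m.act → d i = delta G α ρ x i) ∧
      (updateIterateCmd α ρ).run G m = { m with
        q := (nextIterate G α ρ x).q
        d := d
        steps := m.steps + 1 + 14 * m.act.length } := by
    refine ⟨fun i => if i ∈ m.act then -(m.g i + thr G α ρ i) else m.d i, fun i hi => ?_, ?_⟩
    · simp only [hi, if_true, hδ_in i hi, hm.g_eq]
    · rw [updateIterateCmd, run_forActive, foldl_updateIterate G α ρ _ hnd]
      ext i
      · simp only [Mem.tick, nextIterate_q, Pi.add_apply, hm.q_eq, hm.g_eq]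
        by_cases hi : i ∈ m.act
        · rw [if_pos hi, hδ_in i hi]
        · rw [if_neg hi, hδ_out i hi, add_zero]
      all_goals rfl
  have h2 : (updateGradientCmd α ρ).run G ((updateIterateCmd α ρ).run G m) = { m with
        q := (nextIterate G α ρ x).q
        g := (nextIterate G α ρ x).g
        d := d
        steps := m.steps + 3 + 28 * m.act.length + 17 * nbrCount G m } := by
    have e : (updateGradientCmd α ρ : Cmd n) = .seq
        (.forActive fun i => .write .g i (.sub (.sub (.const 0) (thrExpr α ρ i))
          (.mul (.const ((1 - α) / 2)) (.read .d i))))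
        (.forActive fun l => .forNbr l (sendCmd α l)) := rfl
    rw [h1, e, run_seq, run_forActive, run_forActive, foldl_resetGradient G α ρ _ hnd,
      foldl_sendAll]
    ext i
    · rfl
    · simp only [Mem.tick]
      have hsum : (m.act.map (contribution G α d i)).sum = (1 - α) / 2 *
          ∑ j, G.A i j * delta G α ρ x j / (Real.sqrt (G.deg i) * Real.sqrt (G.deg j)) := by
        rw [← List.sum_toFinset _ hnd, Finset.mul_sum]
        refine Finset.sum_subset_zero_on_sdiff (Finset.subset_univ _) (fun j hj => ?_)
          fun j hj => ?_
        · rw [hδ_out j (by simpa using hj)]; simp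
        · rw [contribution, hd_in j (by simpa using hj)]
          have hi := (Real.sqrt_pos.2 (hd i)).ne'
          have hj := (Real.sqrt_pos.2 (hd j)).ne'
          field_simp
      rw [hsum, nextIterate_g hd, Pi.add_apply, G.Q_mulVec_apply hd, hm.g_eq]
      by_cases hi : i ∈ m.act
      · rw [if_pos hi, hd_in i hi, hδ_in i hi]; ring
      · rw [if_neg hi, hδ_out i hi]; ring
    all_goals try rfl
    simp only [Mem.tick, nbrCount]
    omega
  set m₂ := (updateGradientCmd α ρ).run G ((updateIterateCmd α ρ).run G m) with hm₂
  have hc₂ : Consistent m₂ := by rw [h2]; exact hm.consistent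
  have h3 := run_updateActive G α ρ hc₂
  have hact : m₂.act = m.act := by rw [h2]
  have hq₂ : m₂.q = (nextIterate G α ρ x).q := by rw [h2]
  have hg₂ : m₂.g = (nextIterate G α ρ x).g := by rw [h2]
  have hsteps : m₂.steps = m.steps + 3 + 28 * m.act.length + 17 * nbrCount G m := by rw [h2]
  have e : (bodyCmd α ρ).run G m = (updateActiveCmd α ρ).run G m₂ := by
    rw [bodyCmd, run_seq, run_seq]
  rw [e]
  obtain ⟨h3a, h3b, h3c, h3d⟩ := h3
  refine ⟨⟨?_, ?_, ?_, h3b, fun i => ?_⟩, ?_⟩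
  · rw [h3a]; exact hq₂
  · rw [h3a]; exact hg₂
  · rw [h3a, ← hm.out_eq]; change m₂.out = m.out; rw [h2]
  · rw [h3c, hq₂, hg₂, hact]
    constructor
    · rintro (hi | ⟨-, hi⟩)
      · exact hnext.thr_lt_of_pos (hx.next_pos ((hm.mem_act i).1 hi))
      · exact hi
    · intro hi
      by_cases hact : i ∈ m.act
      · exact Or.inl hact
      refine Or.inr ⟨?_, hi⟩
      -- a node without neighbours on `act` keeps its entry and its gradient
      by_contra hno
      push Not at hno
      refine hact ((hm.mem_act i).2 ?_)
      have hQ : (G.Q α *ᵥ delta G α ρ x) i = 0 := by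
        rw [G.Q_mulVec_apply hd, hδ_out i hact, Finset.sum_eq_zero]
        · ring
        · intro j _
          by_cases hj : j ∈ m.act
          · have : G.A j i = 0 := not_not.1 (mt (mem_nbrs G).2 (hno j hj))
            rw [G.symm, this]; simp
          · rw [hδ_out j hj]; simp
      rw [nextIterate_q, nextIterate_g hd, Pi.add_apply, Pi.add_apply, hQ, hδ_out i hact] at hi
      simpa using hi
  · rw [hact] at h3d
    rw [nbrCount] at *
    omega

lemma Represents.run_return (hm : Represents G α ρ m x) (hx : IsLowerIterate G α ρ s q x) :
    ((returnCmd (n := n)).run G m).out = (fun i => Real.sqrt (G.deg i) * x.q i) ∧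
      ((returnCmd (n := n)).run G m).steps = m.steps + 1 + 6 * m.act.length := by
  rw [returnCmd, run_forActive, foldl_return]
  refine ⟨funext fun i => ?_, rfl⟩
  by_cases hi : i ∈ m.act
  · simp [hi, Mem.tick, hm.q_eq]
  · have h0 : x.q i = 0 := le_antisymm
      (not_lt.1 fun h => hi ((hm.mem_act i).2 (hx.thr_lt_of_pos h))) (hx.nonneg i)
    simp [hi, Mem.tick, hm.out_eq, h0]

/-- The loop of the program ends after as many turns as the solver takes iterations, and every turn
costs at most a constant times the number of nodes and edges seen from the support of the optimal
point. -/
lemma exists_whileFlag (hq : IsOptimal G α ρ s q) (hd : ∀ i, 0 < G.deg i) (hα : 0 < α)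
    (hα1 : α < 1) (hρ : 0 < ρ) (hs : ∀ i, 0 ≤ s i) {ε : ℝ} (hε : 0 < ε) {T : ℕ}
    (hT : StopsAfter G α ρ ε s T) (j k : ℕ) (hjk : k + j = T) (m : Mem n)
    (hm : Represents G α ρ m (iterate G α ρ s k)) :
    ∃ m', WhileFlag G (testCmd α ρ ε) (bodyCmd α ρ) m m' ∧
      Represents G α ρ m' (iterate G α ρ s T) ∧
      m'.steps ≤ m.steps + (j + 1) * (7 + 39 * (supp q).card + 28 * G.volHat (supp q)) := by
  have test : ∀ k m, Represents G α ρ m (iterate G α ρ s k) →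
      Represents G α ρ (((testCmd α ρ ε).run G m).tick 1) (iterate G α ρ s k) ∧
      (((testCmd α ρ ε).run G m).flag = false ↔ Terminates G α ρ ε (iterate G α ρ s k).g) ∧
      (((testCmd α ρ ε).run G m).tick 1).steps ≤ m.steps + 3 + 9 * (supp q).card := by
    intro k m hm
    have hx := isLowerIterate_iterate (s := s) hq hd hα1 k
    obtain ⟨ht, hflag, hsteps⟩ := hm.run_test hx hd hα hα1 hρ hs hε
    have hlen := hm.length_le hx hq hd hα1
    exact ⟨ht.tick 1, hflag, by simp only [Mem.tick]; omega⟩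
  induction j generalizing k m with
  | zero =>
    obtain rfl : k = T := hjk
    obtain ⟨hm₁, hflag, hs₁⟩ := test k m hm
    exact ⟨_, WhileFlag.halt m (hflag.2 hT.1), hm₁, by omega⟩
  | succ j ih =>
    obtain ⟨hm₁, hflag, hs₁⟩ := test k m hm
    have hx := isLowerIterate_iterate (s := s) hq hd hα1 k
    have hgo : ((testCmd α ρ ε).run G m).flag = true := by
      rw [← Bool.not_eq_false, hflag]
      exact hT.2 k (by omega)
    obtain ⟨hm₂, hs₂⟩ := hm₁.run_body hx hq hd hα1
    rw [← iterate_succ] at hm₂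
    obtain ⟨m', hw, hr, hs'⟩ := ih (k + 1) (by omega) _ hm₂
    refine ⟨m', WhileFlag.step m m' hgo hw, hr, hs'.trans ?_⟩
    have h1 := hm₁.length_le hx hq hd hα1
    have h2 := hm₁.nbrCount_le hx hq hd hα1
    rw [add_mul (j + 1) 1]
    omega

lemma exists_haltsWith (hq : IsOptimal G α ρ s q) (hd : ∀ i, 0 < G.deg i) (hα : 0 < α)
    (hα1 : α < 1) (hρ : 0 < ρ) (hs : ∀ i, 0 ≤ s i) {ε : ℝ} (hε : 0 < ε)
    (hne : (supp q).Nonempty) {T : ℕ} (hT : StopsAfter G α ρ ε s T) :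
    ∃ t, HaltsWith G α ρ ε s (fun i => Real.sqrt (G.deg i) * (iterate G α ρ s T).q i) t ∧
      t ≤ 46 * (T + 2) * ((supp q).card + G.volHat (supp q)) := by
  obtain ⟨m, hw, hm, hsteps⟩ := exists_whileFlag hq hd hα hα1 hρ hs hε hT T 0 (zero_add T) _
    represents_init
  have hx := isLowerIterate_iterate (s := s) hq hd hα1 T
  obtain ⟨hout, hst⟩ := hm.run_return hx
  refine ⟨_, ⟨m, hw, hout, rfl⟩, ?_⟩
  have hlen := hm.length_le hx hq hd hα1
  have hcard : 1 ≤ (supp q).card := hne.card_pos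
  have h0 : (initMem G α ρ s).steps = 0 := rfl
  rw [hst]
  have h1 : (T + 1) * (7 + 39 * (supp q).card + 28 * G.volHat (supp q)) ≤
      (T + 1) * (46 * ((supp q).card + G.volHat (supp q))) :=
    Nat.mul_le_mul_left _ (by omega)
  have h2 : 46 * (T + 2) * ((supp q).card + G.volHat (supp q)) =
      (T + 1) * (46 * ((supp q).card + G.volHat (supp q))) +
        46 * ((supp q).card + G.volHat (supp q)) := by ring
  omega

end Simulation

end LocalPageRank

theorem mainTheorem3 :
    ∃ C : ℝ, 0 < C ∧
      ∀ (n : ℕ) (G : LocalPageRank.WGraph n) (α ε ρ : ℝ) (s qStar : Fin n → ℝ),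
        (∀ i, 0 < G.deg i) →
        0 < α → α < 1 → 0 < ε → ε < 1 → 0 < ρ →
        (∀ i, 0 ≤ s i) → ∑ i, s i = 1 → ρ ≤ ‖s‖ →
        (∑ i, |s i|) / ρ ≤ G.vol Finset.univ / 2 →
        IsMinOn (G.psi α ρ s) Set.univ qStar →
        (LocalPageRank.supp qStar).Nonempty →
        ∃ T t : ℕ,
          LocalPageRank.StopsAfter G α ρ ε s T ∧
          LocalPageRank.Terminates G α ρ ε
            (LocalPageRank.gradAt (G.f α s) (LocalPageRank.iterate G α ρ s T).q) ∧
          (T : ℝ) ≤ C * (1 / G.mu α (LocalPageRank.supp qStar) *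
            Real.log (2 / (ε ^ 2 * ρ ^ 2 * α ^ 2 * ⨅ j, G.deg j))) ∧
          LocalPageRank.HaltsWith G α ρ ε s
            (fun i => Real.sqrt (G.deg i) * (LocalPageRank.iterate G α ρ s T).q i) t ∧
          (t : ℝ) ≤ C * ((((LocalPageRank.supp qStar).card : ℝ) +
              (G.volHat (LocalPageRank.supp qStar) : ℝ)) / G.mu α (LocalPageRank.supp qStar) *
            Real.log (2 / (ε ^ 2 * ρ ^ 2 * α ^ 2 * ⨅ j, G.deg j))) ∧
          ∀ K : ℝ,
            ((LocalPageRank.supp qStar).card : ℝ) ≤ K * G.vol (LocalPageRank.supp qStar) →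
            (G.volHat (LocalPageRank.supp qStar) : ℝ) ≤ K * G.vol (LocalPageRank.supp qStar) →
            (t : ℝ) ≤ C * K * (2 / (ρ * G.mu α (LocalPageRank.supp qStar)) *
              Real.log (2 / (ε ^ 2 * ρ ^ 2 * α ^ 2 * ⨅ j, G.deg j))) := by
  -- `T ≤ 4 L / μ` and `t ≤ 46 (T + 2) (|S_*| + volHat S_*)`, where `T + 2 ≤ 8 L / μ`
  refine ⟨368, by norm_num, ?_⟩
  intro n G α ε ρ s q hd hα hα1 hε hε1 hρ hs hs1 hρs hsvol hmin hne
  have hq := LocalPageRank.isOptimal_of_isMinOn hd hα hα1 hρ hs hmin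
  have hvρ := hq.mul_vol_supp_le hd hα hα1 hs hs1
  have hvol : G.vol (LocalPageRank.supp q) ≤ G.vol Finset.univ / 2 := by
    refine le_trans ?_ hsvol
    rw [Finset.sum_congr rfl fun i _ => abs_of_nonneg (hs i), hs1, le_div_iff₀ hρ]
    linarith
  have hρ1 : ρ ≤ 1 := hρs.trans <| (pi_norm_le_iff_of_nonneg zero_le_one).2 fun i => by
    rw [Real.norm_of_nonneg (hs i), ← hs1]
    exact Finset.single_le_sum (fun j _ => hs j) (Finset.mem_univ i)
  obtain ⟨i₀, hi₀⟩ := hne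
  have : Nonempty (Fin n) := ⟨i₀⟩
  set δ := ⨅ j, G.deg j with hδdef
  have hδd : ∀ i, δ ≤ G.deg i := fun i => ciInf_le (Set.finite_range _).bddBelow i
  have hδ : 0 < δ := by
    obtain ⟨j, hj⟩ := exists_eq_ciInf_of_finite (f := G.deg)
    rw [hδdef, ← hj]; exact hd j
  have hρδ : ρ * δ ≤ 1 := by
    have h1 : G.deg i₀ ≤ G.vol (LocalPageRank.supp q) :=
      Finset.single_le_sum (f := G.deg) (fun j _ => (hd j).le) hi₀
    exact (mul_le_mul_of_nonneg_left ((hδd i₀).trans h1) hρ.le).trans hvρ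
  set L := Real.log (2 / (ε ^ 2 * ρ ^ 2 * α ^ 2 * δ)) with hL
  set μ := G.mu α (LocalPageRank.supp q) with hμdef
  have hL2 : 1 / 2 ≤ L := by
    have hB : ε ^ 2 * ρ ^ 2 * α ^ 2 * δ ≤ 1 := by
      have h1 : (ε * α) ^ 2 ≤ 1 :=
        pow_le_one₀ (by positivity) (mul_le_one₀ hε1.le hα.le hα1.le)
      calc ε ^ 2 * ρ ^ 2 * α ^ 2 * δ = (ε * α) ^ 2 * (ρ * (ρ * δ)) := by ring
        _ ≤ 1 := mul_le_one₀ h1 (by positivity) (mul_le_one₀ hρ1 (by positivity) hρδ)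
    have h2 : Real.log 2 ≤ L := by
      refine Real.log_le_log two_pos ?_
      rw [le_div_iff₀ (by positivity)]
      linarith
    linarith [Real.log_two_gt_d9]
  have hμ : 0 < μ := hα.trans_le (G.le_mu hα1.le _)
  have hμ1 : μ ≤ 1 := LocalPageRank.mu_le_one hd hα1 hvol ⟨i₀, hi₀⟩
  have hLμ : 1 ≤ 2 * (L / μ) := by
    rw [← mul_div_assoc, le_div_iff₀ hμ]; linarith
  obtain ⟨T, hT, hTle⟩ := LocalPageRank.exists_stopsAfter hq hd hα hα1 hρ hρ1 hs hs1 hvol hε hε1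
    hδ hδd (by rw [← hL]; linarith)
  rw [← hL, ← hμdef, mul_div_assoc] at hTle
  obtain ⟨t, ht, htle⟩ := LocalPageRank.exists_haltsWith hq hd hα hα1 hρ hs hε ⟨i₀, hi₀⟩ hT
  set a := (LocalPageRank.supp q).card
  set v := G.volHat (LocalPageRank.supp q)
  have htle' : (t : ℝ) ≤ 368 * (((a : ℝ) + v) * (L / μ)) := by
    have h1 : (t : ℝ) ≤ 46 * (T + 2) * (a + v) := by exact_mod_cast htle
    have h2 : 46 * ((T : ℝ) + 2) ≤ 368 * (L / μ) := by linarith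
    have h3 := mul_le_mul_of_nonneg_right h2 (by positivity : (0 : ℝ) ≤ (a : ℝ) + v)
    linarith
  refine ⟨T, t, hT, ?_, ?_, ht, ?_, fun K hK1 hK2 => ?_⟩
  · rw [G.gradAt_f hd, ← (LocalPageRank.isLowerIterate_iterate hq hd hα1 T).g_eq]
    exact hT.1
  · rw [one_div_mul_eq_div]; linarith
  · rw [div_mul_eq_mul_div, mul_div_assoc]; exact htle'
  · have hV : 0 < G.vol (LocalPageRank.supp q) := Finset.sum_pos (fun i _ => hd i) ⟨i₀, hi₀⟩
    have hK : 0 ≤ K := nonneg_of_mul_nonneg_left ((Nat.cast_nonneg a).trans hK1) hV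
    have hVρ : G.vol (LocalPageRank.supp q) ≤ 1 / ρ := by
      rw [le_div_iff₀ hρ]; linarith
    have h1 : (a : ℝ) + v ≤ 2 * (K * (1 / ρ)) := by
      linarith [mul_le_mul_of_nonneg_left hVρ hK]
    have h2 := mul_le_mul_of_nonneg_right h1 (by positivity : 0 ≤ L / μ)
    calc (t : ℝ) ≤ 368 * (((a : ℝ) + v) * (L / μ)) := htle'
      _ ≤ 368 * (2 * (K * (1 / ρ)) * (L / μ)) := by linarith
      _ = 368 * K * (2 / (ρ * μ) * L) := by field_simp
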